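/- Let $d\ge 1$ be an integer and let $s\ge d$ be real. For a finite set $\omega\subset\mathbb{R}^d$ put $E_s(\omega)=\sum_{x\ne y\in\omega}|x-y|^{-s}$ (sum over ordered pairs of distinct points, $|\cdot|$ the Euclidean norm). For $A\subset\mathbb{R}^d$ and $N\in\mathbb{N}$ let $$\mathcal{E}_s(A,N)=\inf\{E_s(\omega):\ \omega\subset A,\ \omega \text{ has exactly } N \text{ points}\}\in[0,\infty]\qquad(\inf\emptyset=\infty),$$ and let $\tau_{s,d}(N)=N^{1+s/d}$ if $s>d$ and $\tau_{d,d}(N)=N^2\log N$ if $s=d$. Write $$g_{s,d}(A)=\lim_{N\to\infty}\frac{\mathcal{E}_s(A,N)}{\tau_{s,d}(N)}$$ when this limit exists in $[0,\infty]$. Let $U^d=[0,1]^d$ and let $\mathcal{H}_d$ be Lebesgue measure on $\mathbb{R}^d$. Then $g_{s,d}(U^d)$ exists and is finite and positive, and for every bounded Lebesgue measurable set $A\subset\mathbb{R}^d$ whose boundary has Lebesgue measure zero, the limit $g_{s,d}(A)$ exists in $[0,\infty]$ and $$g_{s,d}(A)=g_{s,d}(U^d)\,\mathcal{H}_d(A)^{-s/d},$$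 where the right-hand side is $\infty$ if $\mathcal{H}_d(A)=0$. -/

import Mathlib

open MeasureTheory Filter Topology
open scoped ENNReal

noncomputable section

open Classical in
/-- The Riesz `s`-energy `∑_{x ≠ y ∈ ω} 1 / |x - y|^s` of a finite set of points; the sum runs over
ordered pairs of distinct points, so each unordered pair is counted twice. -/
def rieszEnergy {n : ℕ} (s : ℝ) (ω : Finset (EuclideanSpace ℝ (Fin n))) : ℝ :=
  ∑ p ∈ ω.offDiag, 1 / ‖p.1 - p.2‖ ^ s

/-- The `N`-point minimal `s`-energy over `A`: the infimum of the (nonnegative) energies of the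
`N`-point subsets of `A`. It is `∞` if `A` has fewer than `N` points. -/
def minRieszEnergy {n : ℕ} (s : ℝ) (A : Set (EuclideanSpace ℝ (Fin n))) (N : ℕ) : ℝ≥0∞ :=
  ⨅ (ω : Finset (EuclideanSpace ℝ (Fin n))) (_ : (ω : Set (EuclideanSpace ℝ (Fin n))) ⊆ A)
    (_ : ω.card = N), ENNReal.ofReal (rieszEnergy s ω)

/-- The normalization `τ_{s,d}(N)`, for `s ≥ d`. -/
def rieszTau (s : ℝ) (d N : ℕ) : ℝ :=
  if s = (d : ℝ) then (N : ℝ) ^ 2 * Real.log N else (N : ℝ) ^ (1 + s / (d : ℝ))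

/-- The normalized minimal energy `𝓖_{s,d}(A, N) = 𝓔_s(A, N) / τ_{s,d}(N)`. -/
def normRieszEnergy {n : ℕ} (s : ℝ) (d : ℕ) (A : Set (EuclideanSpace ℝ (Fin n))) (N : ℕ) : ℝ≥0∞ :=
  minRieszEnergy s A N / ENNReal.ofReal (rieszTau s d N)

/-- `g_{s,d}(A)` exists, as an extended real number, and equals `g`. -/
def HasRieszLimit {n : ℕ} (s : ℝ) (d : ℕ) (A : Set (EuclideanSpace ℝ (Fin n))) (g : ℝ≥0∞) : Prop :=
  Tendsto (fun N : ℕ => normRieszEnergy s d A N) atTop (𝓝 g)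

/-- A Lebesgue measurable subset of `ℝ^d` whose boundary has Lebesgue measure zero. -/
def IsAlmostClopen {d : ℕ} (A : Set (EuclideanSpace ℝ (Fin d))) : Prop :=
  NullMeasurableSet A volume ∧ volume (frontier A) = 0

/-- The unit cube `U^d = [0,1]^d`. -/
def unitCube (d : ℕ) : Set (EuclideanSpace ℝ (Fin d)) :=
  {x | ∀ i, x i ∈ Set.Icc (0 : ℝ) 1}

end

/-! For s > d the argument is self-similarity on a fine grid, with the liminf of the normalized
energies of the unit cube as the candidate constant. Below: split a configuration into its grid
cells, discard the interaction between cells, rescale each piece to the unit cube, and recombine by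
convexity of n ↦ n^(1+s/d). The number of cells, about volume · m^d, produces the factor
volume^(-s/d), and the mesh cancels (`exists_sub_le_rieszEnergy`). Above: choose one N₀-point
configuration in the cube whose energy is close to the liminf, and put a slightly contracted copy in
each cell contained in A. Contraction separates the cells, so the cross terms are bounded by a
convergent lattice sum times N₀², which is negligible against N₀^(1+s/d)
(`exists_rieszEnergy_le_of_grid`, `eventually_exists_rieszEnergy_le`). Both bounds meet at the
liminf, so the limit exists.

For s = d the lattice sum diverges logarithmically, and the constant is found explicitly: it is the
volume β of the unit ball. Above, points are added greedily where the potential is at most its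
average over A minus small balls; that average is a shell integral of |z|^(-d), with leading part β
log N times N / volume (`exists_rieszEnergy_le_log`). Below, |x|^(-d) is written as a Mellin
integral of Gaussians exp(-t|x|²). Each Gaussian is a convolution square, so Cauchy–Schwarz bounds
its energy from below (`le_sum_sum_exp`), and integrating up to t = N^(2/d) yields the logarithm
with the same β (`le_gamma_mul_rieszEnergy`).

In both cases the bounds hold for perturbed constants and volumes; `tendsto_mul_rpow_neg_of_bounds`
removes the perturbation. The null boundary makes the volumes of A, its closure and its inner grid
approximations agree. -/

noncomputable section

/-! ### Elementary properties of the Riesz energy -/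

section Energy

variable {n : ℕ} {s : ℝ}

lemma rieszEnergy_nonneg (s : ℝ) (ω : Finset (EuclideanSpace ℝ (Fin n))) :
    0 ≤ rieszEnergy s ω :=
  Finset.sum_nonneg fun _ _ => by positivity

lemma rieszEnergy_mono {ω ω' : Finset (EuclideanSpace ℝ (Fin n))} (h : ω ⊆ ω') :
    rieszEnergy s ω ≤ rieszEnergy s ω' := by
  classical
  refine Finset.sum_le_sum_of_subset_of_nonneg (fun p hp => ?_) fun _ _ _ => by positivity
  simp only [Finset.mem_offDiag] at hp ⊢
  exact ⟨h hp.1, h hp.2.1, hp.2.2⟩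

open Classical in
lemma rieszEnergy_image {f : EuclideanSpace ℝ (Fin n) → EuclideanSpace ℝ (Fin n)} {c : ℝ}
    (hc : 0 < c) (hf : ∀ x y, ‖f x - f y‖ = c * ‖x - y‖)
    (ω : Finset (EuclideanSpace ℝ (Fin n))) :
    rieszEnergy s (ω.image f) = rieszEnergy s ω / c ^ s := by
  have hinj : Function.Injective f := fun x y hxy => by
    have := hf x y
    rw [hxy, sub_self, norm_zero, eq_comm, mul_eq_zero] at this
    exact sub_eq_zero.1 (norm_eq_zero.1 (this.resolve_left hc.ne'))
  have hoff : (ω.image f).offDiag = ω.offDiag.image (Prod.map f f) := by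
    ext ⟨x, y⟩
    simp only [Finset.mem_offDiag, Finset.mem_image, Prod.map, Prod.mk.injEq, Prod.exists]
    constructor
    · rintro ⟨⟨a, ha, rfl⟩, ⟨b, hb, rfl⟩, hab⟩
      exact ⟨a, b, ⟨ha, hb, fun h => hab (h ▸ rfl)⟩, rfl, rfl⟩
    · rintro ⟨a, b, ⟨ha, hb, hab⟩, rfl, rfl⟩
      exact ⟨⟨a, ha, rfl⟩, ⟨b, hb, rfl⟩, hinj.ne hab⟩
  unfold rieszEnergy
  rw [hoff, Finset.sum_image fun _ _ _ _ h => (hinj.prodMap hinj) h, Finset.sum_div]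
  refine Finset.sum_congr rfl fun p _ => ?_
  simp only [Prod.map_fst, Prod.map_snd]
  rw [hf, Real.mul_rpow hc.le (norm_nonneg _), div_div, mul_comm]

/-- Discarding the interaction between the fibres of a map can only decrease the energy. -/
lemma sum_rieszEnergy_fiber_le {κ : Type*} [DecidableEq κ]
    (φ : EuclideanSpace ℝ (Fin n) → κ) (T : Finset κ)
    (ω : Finset (EuclideanSpace ℝ (Fin n))) :
    ∑ k ∈ T, rieszEnergy s (ω.filter (φ · = k)) ≤ rieszEnergy s ω := by
  classical
  unfold rieszEnergy
  rw [← Finset.sum_biUnion]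
  · refine Finset.sum_le_sum_of_subset_of_nonneg (fun p hp => ?_) fun _ _ _ => by positivity
    simp only [Finset.mem_biUnion, Finset.mem_offDiag, Finset.mem_filter] at hp ⊢
    obtain ⟨k, -, h1, h2, h3⟩ := hp
    exact ⟨h1.1, h2.1, h3⟩
  · intro k _ l _ hkl
    rw [Function.onFun, Finset.disjoint_left]
    intro p hp hp'
    simp only [Finset.mem_offDiag, Finset.mem_filter] at hp hp'
    exact hkl (hp.1.2.symm.trans hp'.1.2)

/-- A configuration of small diameter has large energy. -/
lemma card_sub_one_mul_le_rieszEnergy {D : ℝ} (hs : 0 ≤ s) (hD : 0 < D)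
    (ω : Finset (EuclideanSpace ℝ (Fin n))) (h : ∀ x ∈ ω, ∀ y ∈ ω, ‖x - y‖ ≤ D) :
    ((ω.card : ℝ) - 1) * (1 / D ^ s) ≤ rieszEnergy s ω := by
  classical
  have hcard : ((ω.card : ℝ) - 1) ≤ (ω.offDiag.card : ℝ) := by
    rw [Finset.offDiag_card, Nat.cast_sub (Nat.le_mul_self _)]
    push_cast
    nlinarith [sq_nonneg ((ω.card : ℝ) - 1)]
  calc ((ω.card : ℝ) - 1) * (1 / D ^ s) ≤ (ω.offDiag.card : ℝ) * (1 / D ^ s) := by gcongr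
    _ = ∑ _p ∈ ω.offDiag, 1 / D ^ s := by rw [Finset.sum_const, nsmul_eq_mul]
    _ ≤ rieszEnergy s ω := by
      unfold rieszEnergy
      refine (Finset.sum_le_sum fun p hp => ?_).trans_eq
        (Finset.sum_congr (by congr) fun _ _ => rfl)
      simp only [Finset.mem_offDiag] at hp
      have : 0 < ‖p.1 - p.2‖ := norm_pos_iff.2 (sub_ne_zero.2 hp.2.2)
      have := h _ hp.1 _ hp.2.1
      gcongr

lemma le_minRieszEnergy {A : Set (EuclideanSpace ℝ (Fin n))} {N : ℕ} {c : ℝ}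
    (h : ∀ ω : Finset (EuclideanSpace ℝ (Fin n)), ↑ω ⊆ A → ω.card = N → c ≤ rieszEnergy s ω) :
    ENNReal.ofReal c ≤ minRieszEnergy s A N :=
  le_iInf fun ω => le_iInf fun h1 => le_iInf fun h2 => ENNReal.ofReal_le_ofReal (h ω h1 h2)

/-- Removing points lowers the energy, so a construction may overshoot N instead of hitting it
exactly. -/
lemma minRieszEnergy_le {A : Set (EuclideanSpace ℝ (Fin n))} {N : ℕ}
    {ω : Finset (EuclideanSpace ℝ (Fin n))} (h1 : ↑ω ⊆ A) (h2 : N ≤ ω.card) :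
    minRieszEnergy s A N ≤ ENNReal.ofReal (rieszEnergy s ω) := by
  obtain ⟨ω', hω', hc⟩ := Finset.exists_subset_card_eq h2
  refine (iInf_le _ ω').trans ((iInf_le _ ((Finset.coe_subset.2 hω').trans h1)).trans
    ((iInf_le _ hc).trans ?_))
  exact ENNReal.ofReal_le_ofReal (rieszEnergy_mono hω')

lemma le_normRieszEnergy {A : Set (EuclideanSpace ℝ (Fin n))} {d N : ℕ} {a : ℝ}
    (hτ : 0 < rieszTau s d N)
    (h : ∀ ω : Finset (EuclideanSpace ℝ (Fin n)), ↑ω ⊆ A → ω.card = N →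
      a * rieszTau s d N ≤ rieszEnergy s ω) :
    ENNReal.ofReal a ≤ normRieszEnergy s d A N := by
  rw [normRieszEnergy, ENNReal.le_div_iff_mul_le (Or.inl (by simpa using hτ)) (Or.inl (by simp)),
    ← ENNReal.ofReal_mul' hτ.le]
  exact le_minRieszEnergy h

lemma normRieszEnergy_le {A : Set (EuclideanSpace ℝ (Fin n))} {d N : ℕ} {a : ℝ}
    (hτ : 0 < rieszTau s d N) {ω : Finset (EuclideanSpace ℝ (Fin n))} (h1 : ↑ω ⊆ A)
    (h2 : N ≤ ω.card) (h : rieszEnergy s ω ≤ a * rieszTau s d N) :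
    normRieszEnergy s d A N ≤ ENNReal.ofReal a := by
  rw [normRieszEnergy, ENNReal.div_le_iff (by simpa using hτ) (by simp),
    ← ENNReal.ofReal_mul' hτ.le]
  exact (minRieszEnergy_le h1 h2).trans (ENNReal.ofReal_le_ofReal h)

/-- If the normalized minimal energy is less than `a`, some configuration realizes this. -/
lemma exists_rieszEnergy_lt {A : Set (EuclideanSpace ℝ (Fin n))} {d N : ℕ} {a : ℝ}
    (hτ : 0 < rieszTau s d N) (h : normRieszEnergy s d A N < ENNReal.ofReal a) :
    ∃ ω : Finset (EuclideanSpace ℝ (Fin n)), ↑ω ⊆ A ∧ ω.card = N ∧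
      rieszEnergy s ω < a * rieszTau s d N := by
  by_contra! H
  exact h.not_ge (le_normRieszEnergy hτ H)

end Energy

/-! ### Passing from perturbed bounds to the limit -/

section Limit

/-- Identification of a limit from one-sided bounds in which both factors are perturbed. -/
lemma tendsto_mul_rpow_neg_of_bounds {F : ℕ → ℝ≥0∞} {g V : ℝ≥0∞} {p : ℝ} (hp : 0 < p)
    (hg : 0 < g) (hg' : g < ∞) (hV : V < ∞)
    (hU : ∀ a v : ℝ, g < ENNReal.ofReal a → 0 < v → ENNReal.ofReal v < V →
      ∀ᶠ N in atTop, F N ≤ ENNReal.ofReal (a * v ^ (-p)))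
    (hL : ∀ a v : ℝ, 0 < a → ENNReal.ofReal a < g → 0 < v → V < ENNReal.ofReal v →
      ∀ᶠ N in atTop, ENNReal.ofReal (a * v ^ (-p)) ≤ F N) :
    Tendsto F atTop (𝓝 (g * V ^ (-p))) := by
  -- Multiplication is continuous here even at V = 0, where the power is ∞, because g is neither 0
  -- nor ∞.
  have key : ∀ {l : Filter (ℝ≥0∞ × ℝ≥0∞)}, l ≤ 𝓝 (g, V) →
      Tendsto (fun q : ℝ≥0∞ × ℝ≥0∞ => q.1 * q.2 ^ (-p)) l (𝓝 (g * V ^ (-p))) := by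
    intro l hl
    refine ENNReal.Tendsto.mul ((continuous_fst.tendsto (g, V)).mono_left hl) (Or.inl hg.ne')
      ?_ (Or.inr hg'.ne)
    exact (((ENNReal.continuous_rpow_const (y := -p)).comp continuous_snd).tendsto
      (g, V)).mono_left hl
  have conv : ∀ {a v : ℝ≥0∞}, a ≠ ∞ → v ≠ 0 → v ≠ ∞ →
      ENNReal.ofReal (a.toReal * v.toReal ^ (-p)) = a * v ^ (-p) := by
    intro a v ha hv0 hv
    rw [ENNReal.ofReal_mul ENNReal.toReal_nonneg, ENNReal.ofReal_toReal ha,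
      ← ENNReal.ofReal_rpow_of_pos (ENNReal.toReal_pos hv0 hv), ENNReal.ofReal_toReal hv]
  refine tendsto_of_le_liminf_of_limsup_le ?_ ?_
  · have hne : (𝓝[<] g ×ˢ 𝓝[>] V).NeBot := by
      have := nhdsLT_neBot_of_exists_lt ⟨0, hg⟩
      have := nhdsGT_neBot_of_exists_gt ⟨∞, hV⟩
      infer_instance
    have hle : 𝓝[<] g ×ˢ 𝓝[>] V ≤ 𝓝 (g, V) := by
      rw [nhds_prod_eq]; exact Filter.prod_mono nhdsWithin_le_nhds nhdsWithin_le_nhds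
    refine le_of_tendsto (key hle) ?_
    have h1 : ∀ᶠ a in 𝓝[<] g, 0 < a ∧ a < g := Ioo_mem_nhdsLT hg
    have h2 : ∀ᶠ v in 𝓝[>] V, V < v ∧ v < ∞ := Ioo_mem_nhdsGT hV
    filter_upwards [h1.prod_mk h2] with q ⟨⟨ha0, ha⟩, hv, hv'⟩
    have ha' := (ha.trans hg').ne
    have hv0 := ((zero_le (a := V)).trans_lt hv).ne'
    refine le_liminf_of_le (by isBoundedDefault) ?_
    rw [← conv ha' hv0 hv'.ne]
    exact hL _ _ (ENNReal.toReal_pos ha0.ne' ha') (by rwa [ENNReal.ofReal_toReal ha'])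
      (ENNReal.toReal_pos hv0 hv'.ne) (by rwa [ENNReal.ofReal_toReal hv'.ne])
  -- At V = 0 no v lies strictly below V, but the claimed limit is ∞ and the upper bound is trivial.
  · rcases eq_or_ne V 0 with rfl | hV0
    · rw [ENNReal.zero_rpow_of_neg (by linarith), ENNReal.mul_top hg.ne']
      exact le_top
    have hne : (𝓝[>] g ×ˢ 𝓝[<] V).NeBot := by
      have := nhdsGT_neBot_of_exists_gt ⟨∞, hg'⟩
      have := nhdsLT_neBot_of_exists_lt ⟨0, pos_iff_ne_zero.2 hV0⟩
      infer_instance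
    have hle : 𝓝[>] g ×ˢ 𝓝[<] V ≤ 𝓝 (g, V) := by
      rw [nhds_prod_eq]; exact Filter.prod_mono nhdsWithin_le_nhds nhdsWithin_le_nhds
    refine ge_of_tendsto (key hle) ?_
    have h1 : ∀ᶠ a in 𝓝[>] g, g < a ∧ a < ∞ := Ioo_mem_nhdsGT hg'
    have h2 : ∀ᶠ v in 𝓝[<] V, 0 < v ∧ v < V := Ioo_mem_nhdsLT (pos_iff_ne_zero.2 hV0)
    filter_upwards [h1.prod_mk h2] with q ⟨⟨ha, ha'⟩, hv0, hv⟩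
    have hv' := (hv.trans hV).ne
    refine limsup_le_of_le (by isBoundedDefault) ?_
    rw [← conv ha'.ne hv0.ne' hv']
    exact hU _ _ (by rwa [ENNReal.ofReal_toReal ha'.ne])
      (ENNReal.toReal_pos hv0.ne' hv') (by rwa [ENNReal.ofReal_toReal hv'])

end Limit

/-! ### Covering and packing by cells of mesh 1 / m -/

section Grid

variable {d : ℕ}

/-- The index of the cube of the grid of mesh `1 / m` which contains `x`. -/
def gridIndex (m : ℕ) (x : EuclideanSpace ℝ (Fin d)) : Fin d → ℤ := fun i => ⌊(m : ℝ) * x i⌋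

lemma gridIndex_eq_iff {m : ℕ} {x : EuclideanSpace ℝ (Fin d)} {k : Fin d → ℤ} :
    gridIndex m x = k ↔ ∀ i, (k i : ℝ) ≤ m * x i ∧ (m : ℝ) * x i < k i + 1 := by
  simp only [funext_iff, gridIndex, Int.floor_eq_iff]

lemma norm_sub_le_of_gridIndex_eq {m : ℕ} (hm : 0 < m) {x y : EuclideanSpace ℝ (Fin d)}
    (h : gridIndex m x = gridIndex m y) : ‖x - y‖ ≤ d / m := by
  have hm' : (0 : ℝ) < m := by exact_mod_cast hm
  have hx := gridIndex_eq_iff.1 h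
  have hy := gridIndex_eq_iff.1 (rfl : gridIndex m y = _)
  rw [EuclideanSpace.norm_eq]
  refine Real.sqrt_le_iff.2 ⟨by positivity, ?_⟩
  calc ∑ i, ‖(x - y) i‖ ^ 2 ≤ ∑ _i : Fin d, (1 / (m : ℝ)) ^ 2 := by
        refine Finset.sum_le_sum fun i _ => ?_
        have : ‖(x - y) i‖ ≤ 1 / m := by
          rw [Real.norm_eq_abs, abs_le, PiLp.sub_apply, neg_le, le_div_iff₀ hm', le_div_iff₀ hm']
          constructor <;> nlinarith [hx i, hy i]
        gcongr
    _ = d * (1 / (m : ℝ)) ^ 2 := by simp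
    _ ≤ (d : ℝ) ^ 2 * (1 / (m : ℝ)) ^ 2 := by
        gcongr
        exact_mod_cast Nat.le_self_pow two_ne_zero d
    _ = (d / (m : ℝ)) ^ 2 := by ring

lemma gridIndex_fiber_eq {m : ℕ} (hm : 0 < m) (k : Fin d → ℤ) :
    {x : EuclideanSpace ℝ (Fin d) | gridIndex m x = k} =
      (MeasurableEquiv.toLp 2 (Fin d → ℝ)).symm ⁻¹'
        (Set.univ.pi fun i => Set.Ico ((k i : ℝ) / m) ((k i + 1) / m)) := by
  have hm' : (0 : ℝ) < m := by exact_mod_cast hm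
  ext x
  simp only [Set.mem_ofPred_eq, gridIndex_eq_iff, Set.mem_preimage, Set.mem_pi, Set.mem_univ,
    true_imp_iff, Set.mem_Ico, div_le_iff₀ hm', lt_div_iff₀ hm', mul_comm (m : ℝ)]
  rfl

lemma measurableSet_gridIndex_fiber {m : ℕ} (hm : 0 < m) (k : Fin d → ℤ) :
    MeasurableSet {x : EuclideanSpace ℝ (Fin d) | gridIndex m x = k} := by
  rw [gridIndex_fiber_eq hm]
  exact (MeasurableEquiv.toLp 2 (Fin d → ℝ)).symm.measurable
    (MeasurableSet.univ_pi fun i => measurableSet_Ico)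

lemma volume_gridIndex_fiber {m : ℕ} (hm : 0 < m) (k : Fin d → ℤ) :
    volume {x : EuclideanSpace ℝ (Fin d) | gridIndex m x = k} =
      ENNReal.ofReal (1 / (m : ℝ) ^ d) := by
  have hm' : (0 : ℝ) < m := by exact_mod_cast hm
  rw [gridIndex_fiber_eq hm,
    (EuclideanSpace.volume_preserving_symm_measurableEquiv_toLp (Fin d)).measure_preimage_equiv,
    Real.volume_pi_Ico]
  have : ∀ i : Fin d, ((k i : ℝ) + 1) / m - k i / m = 1 / m := fun i => by ring
  simp only [this, Finset.prod_const, Finset.card_univ, Fintype.card_fin]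
  rw [← ENNReal.ofReal_pow (by positivity), one_div_pow]

lemma volume_iUnion_gridIndex {m : ℕ} (hm : 0 < m) (K : Finset (Fin d → ℤ)) :
    volume {x : EuclideanSpace ℝ (Fin d) | gridIndex m x ∈ K} =
      ENNReal.ofReal (K.card / (m : ℝ) ^ d) := by
  have : {x : EuclideanSpace ℝ (Fin d) | gridIndex m x ∈ K} =
      ⋃ k ∈ K, {x | gridIndex m x = k} := by ext; simp
  rw [this, measure_biUnion_finset _ fun k _ => measurableSet_gridIndex_fiber hm k]
  · simp only [volume_gridIndex_fiber hm, Finset.sum_const, nsmul_eq_mul]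
    rw [← ENNReal.ofReal_natCast, ← ENNReal.ofReal_mul (by positivity), mul_one_div]
  · intro k _ l _ hkl
    rw [Function.onFun, Set.disjoint_left]
    exact fun x hx hx' => hkl (Eq.trans (Eq.symm hx) hx')

lemma finite_gridIndex_image (m : ℕ) {A : Set (EuclideanSpace ℝ (Fin d))}
    (hA : Bornology.IsBounded A) : (gridIndex m '' A).Finite := by
  obtain ⟨R, hR⟩ := hA.exists_norm_le
  refine (Set.Finite.pi' (t := fun _ => Set.Icc ⌊-(m * R)⌋ ⌊m * R⌋)
    fun _ => Set.finite_Icc _ _).subset ?_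
  rintro _ ⟨x, hx, rfl⟩ i
  have : |x i| ≤ R := (PiLp.norm_apply_le x i).trans (hR x hx)
  have := abs_le.1 this
  have hm : (0 : ℝ) ≤ m := Nat.cast_nonneg m
  refine ⟨Int.floor_le_floor ?_, Int.floor_le_floor ?_⟩ <;> nlinarith

lemma tendsto_volume_cthickening_div {A : Set (EuclideanSpace ℝ (Fin d))}
    (hA : Bornology.IsBounded A) (c : ℝ) :
    Tendsto (fun m : ℕ => volume (Metric.cthickening (c / m) A)) atTop
      (𝓝 (volume (closure A))) := by
  refine (tendsto_measure_cthickening ⟨1, one_pos, ?_⟩).comp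
    (tendsto_const_div_atTop_nhds_zero_nat c)
  exact (hA.cthickening).measure_lt_top.ne

/-- A bounded set is covered by few cubes of a fine grid. -/
lemma eventually_exists_gridIndex_cover {A : Set (EuclideanSpace ℝ (Fin d))}
    (hA : Bornology.IsBounded A) {v : ℝ} (hv : volume (closure A) < ENNReal.ofReal v) :
    ∀ᶠ m : ℕ in atTop, ∃ T : Finset (Fin d → ℤ),
      (∀ x ∈ A, gridIndex m x ∈ T) ∧ (T.card : ℝ) ≤ v * (m : ℝ) ^ d := by
  have hv0 : 0 < v := by simpa using (zero_le (a := volume (closure A))).trans_lt hv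
  filter_upwards [(tendsto_volume_cthickening_div hA d).eventually_lt_const hv,
    eventually_gt_atTop 0] with m hm hm0
  have hm' : (0 : ℝ) < m := by exact_mod_cast hm0
  refine ⟨(finite_gridIndex_image m hA).toFinset, by simpa using fun x hx => ⟨x, hx, rfl⟩, ?_⟩
  set T := (finite_gridIndex_image m hA).toFinset with hT
  -- Cells meeting A lie in the thickening of A by d / m, a crude bound for the diameter of a cell;
  -- compare volumes.
  have : ENNReal.ofReal (T.card / (m : ℝ) ^ d) ≤ ENNReal.ofReal v := by
    rw [← volume_iUnion_gridIndex hm0]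
    refine (measure_mono fun x hx => ?_).trans hm.le
    obtain ⟨y, hy, hxy⟩ : ∃ y ∈ A, gridIndex m y = gridIndex m x := by simpa [hT] using hx
    refine Metric.mem_cthickening_of_dist_le x y _ A hy ?_
    rw [dist_eq_norm]
    exact norm_sub_le_of_gridIndex_eq hm0 hxy.symm
  rwa [ENNReal.ofReal_le_ofReal_iff hv0.le, div_le_iff₀ (by positivity)] at this

/-- A bounded set with negligible boundary contains many cubes of a fine grid. -/
lemma eventually_exists_gridIndex_packing {A : Set (EuclideanSpace ℝ (Fin d))}
    (hA : Bornology.IsBounded A) (hA' : volume (frontier A) = 0) {v : ℝ}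
    (hv : ENNReal.ofReal v < volume A) :
    ∀ᶠ m : ℕ in atTop, ∃ S : Finset (Fin d → ℤ),
      (∀ x : EuclideanSpace ℝ (Fin d), gridIndex m x ∈ S → x ∈ A) ∧
        v * (m : ℝ) ^ d ≤ S.card := by
  classical
  have hfr : Bornology.IsBounded (frontier A) := hA.closure.subset frontier_subset_closure
  have hlim : Tendsto (fun m : ℕ => ENNReal.ofReal v +
      volume (Metric.cthickening (d / m) (frontier A))) atTop (𝓝 (ENNReal.ofReal v)) := by
    have := (tendsto_volume_cthickening_div hfr d).const_add (ENNReal.ofReal v)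
    rwa [isClosed_frontier.closure_eq, hA', add_zero] at this
  filter_upwards [hlim.eventually_lt_const hv, eventually_gt_atTop 0] with m hm hm0
  have hm' : (0 : ℝ) < m := by exact_mod_cast hm0
  set T := (finite_gridIndex_image m hA).toFinset with hT
  set S := T.filter fun k => ∀ x : EuclideanSpace ℝ (Fin d), gridIndex m x = k → x ∈ A with hS
  refine ⟨S, fun x hx => (Finset.mem_filter.1 hx).2 x rfl, ?_⟩
  -- A cell that meets A at x without lying in A contains a point y outside A. The segment from x to
  -- y crosses the frontier, so x is within d / m of it.
  have hcov : A ⊆ {x | gridIndex m x ∈ S} ∪ Metric.cthickening (d / m) (frontier A) := by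
    intro x hx
    by_cases hxS : gridIndex m x ∈ S
    · exact Or.inl hxS
    right
    have hxT : gridIndex m x ∈ T := by simpa [hT] using ⟨x, hx, rfl⟩
    obtain ⟨y, hyx, hyA⟩ : ∃ y : EuclideanSpace ℝ (Fin d), gridIndex m y = gridIndex m x ∧
        y ∉ A := by simpa [hS, hxT] using hxS
    obtain ⟨z, hz, hzA⟩ : (segment ℝ x y ∩ frontier A).Nonempty := by
      by_contra hne
      have hne' : ∀ z ∈ segment ℝ x y, z ∉ frontier A := fun z hz hz' => hne ⟨z, hz, hz'⟩
      have hint : ∀ z ∈ segment ℝ x y, z ∈ A → z ∈ interior A := fun z hz hzA =>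
        by_contra fun h => hne' z hz ⟨subset_closure hzA, h⟩
      have hext : ∀ z ∈ segment ℝ x y, z ∉ A → z ∈ (closure A)ᶜ := fun z hz hzA h =>
        hne' z hz ⟨h, fun h' => hzA (interior_subset h')⟩
      obtain ⟨z, -, hz1, hz2⟩ := (convex_segment x y).isPreconnected _ _ isOpen_interior
        isClosed_closure.isOpen_compl
        (fun z hz => (em (z ∈ A)).imp (hint z hz) (hext z hz))
        ⟨x, left_mem_segment ℝ x y, hint x (left_mem_segment ℝ x y) hx⟩
        ⟨y, right_mem_segment ℝ x y, hext y (right_mem_segment ℝ x y) hyA⟩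
      exact hz2 (subset_closure (interior_subset hz1))
    refine Metric.mem_cthickening_of_dist_le x z _ _ hzA ?_
    have h1 := dist_add_dist_of_mem_segment hz
    have h2 := norm_sub_le_of_gridIndex_eq hm0 hyx.symm
    rw [← dist_eq_norm] at h2
    linarith [dist_nonneg (x := z) (y := y)]
  have h1 := hm.trans_le ((measure_mono hcov).trans (measure_union_le _ _))
  have h2 := lt_of_add_lt_add_right h1
  rw [volume_iUnion_gridIndex hm0] at h2
  have h3 := (ENNReal.ofReal_lt_ofReal_iff').1 h2
  exact ((lt_div_iff₀ (by positivity)).1 h3.1).le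

end Grid

/-! ### Lower bounds by localization to cells -/

section LowerBound

variable {d : ℕ} {s : ℝ}

/-- A lower bound for energies in the unit cube yields one in each cube of the grid. -/
lemma mul_le_rieszEnergy_of_gridIndex_eq {m : ℕ} (hm : 0 < m) {k : Fin d → ℤ} {b : ℝ}
    {ω : Finset (EuclideanSpace ℝ (Fin d))} (hω : ∀ x ∈ ω, gridIndex m x = k)
    (hb : ∀ ω' : Finset (EuclideanSpace ℝ (Fin d)), ↑ω' ⊆ unitCube d → ω'.card = ω.card →
      b ≤ rieszEnergy s ω') :
    (m : ℝ) ^ s * b ≤ rieszEnergy s ω := by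
  classical
  have hm' : (0 : ℝ) < m := by exact_mod_cast hm
  set f : EuclideanSpace ℝ (Fin d) → EuclideanSpace ℝ (Fin d) :=
    fun x => (m : ℝ) • x - WithLp.toLp 2 (fun i => (k i : ℝ)) with hf
  have hfn : ∀ x y, ‖f x - f y‖ = m * ‖x - y‖ := fun x y => by
    rw [hf]
    simp only [sub_sub_sub_cancel_right]
    rw [← smul_sub, norm_smul, Real.norm_of_nonneg hm'.le]
  have hinj : Function.Injective f := fun x y hxy => by
    have h1 : (m : ℝ) • x = (m : ℝ) • y := sub_left_injective hxy
    exact smul_right_injective _ hm'.ne' h1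
  have h := hb (ω.image f) (by
    intro z hz i
    obtain ⟨x, hx, rfl⟩ : ∃ x ∈ ω, f x = z := by simpa using hz
    have := gridIndex_eq_iff.1 (hω x hx) i
    simp only [hf, PiLp.sub_apply, PiLp.smul_apply, smul_eq_mul, Set.mem_Icc]
    constructor <;> linarith) (Finset.card_image_of_injective _ hinj)
  have h2 := rieszEnergy_image (s := s) hm' hfn ω
  have h3 : b ≤ rieszEnergy s ω / (m : ℝ) ^ s := by
    rw [← h2]; convert h
  rwa [le_div_iff₀' (by positivity)] at h3

/-- The energy lower bound for the unit cube passes to bounded sets, with the right dependence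
on the volume of the set. -/
lemma exists_sub_le_rieszEnergy (hd : 0 < d) (hs : 0 ≤ s) {a C : ℝ} (ha : 0 ≤ a)
    (hU : ∀ ω : Finset (EuclideanSpace ℝ (Fin d)), ↑ω ⊆ unitCube d →
      a * (ω.card : ℝ) ^ (1 + s / d) - C ≤ rieszEnergy s ω)
    {A : Set (EuclideanSpace ℝ (Fin d))} (hA : Bornology.IsBounded A) {v : ℝ}
    (hv : volume (closure A) < ENNReal.ofReal v) :
    ∃ C' : ℝ, ∀ ω : Finset (EuclideanSpace ℝ (Fin d)), ↑ω ⊆ A →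
      a * v ^ (-(s / d)) * (ω.card : ℝ) ^ (1 + s / d) - C' ≤ rieszEnergy s ω := by
  classical
  have hv0 : 0 < v := by simpa using (zero_le (a := volume (closure A))).trans_lt hv
  obtain ⟨m, ⟨T, hT, hTc⟩, hm⟩ :=
    ((eventually_exists_gridIndex_cover hA hv).and (eventually_gt_atTop 0)).exists
  have hm' : (0 : ℝ) < m := by exact_mod_cast hm
  have hd' : (0 : ℝ) < d := by exact_mod_cast hd
  have hp : 0 ≤ s / d := by positivity
  -- The mesh is fixed, depending only on A and v, so the accumulated errors of all cells do not
  -- depend on ω.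
  refine ⟨T.card * ((m : ℝ) ^ s * C), fun ω hω => ?_⟩
  have hcard : (ω.card : ℝ) = ∑ k ∈ T, ((ω.filter (gridIndex m · = k)).card : ℝ) := by
    exact_mod_cast Finset.card_eq_sum_card_fiberwise fun x hx => hT x (hω hx)
  -- Power mean inequality over the cells. With at most v m^d cells, the factor `T.card` ^ (s/d) is
  -- at most v^(s/d) m^s, and m^s is exactly what rescaling a cell to the unit cube returns.
  have hpm : (ω.card : ℝ) ^ (1 + s / d) ≤ (v ^ (s / d) * (m : ℝ) ^ s) *
      ∑ k ∈ T, ((ω.filter (gridIndex m · = k)).card : ℝ) ^ (1 + s / d) := by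
    have h1 := Real.rpow_sum_le_const_mul_sum_rpow_of_nonneg (s := T) (p := 1 + s / d)
      (f := fun k => ((ω.filter (gridIndex m · = k)).card : ℝ)) (by linarith)
      (fun _ _ => Nat.cast_nonneg _)
    rw [← hcard, add_sub_cancel_left] at h1
    refine h1.trans ?_
    gcongr
    calc (T.card : ℝ) ^ (s / d) ≤ (v * (m : ℝ) ^ d) ^ (s / d) := by gcongr
      _ = v ^ (s / d) * (m : ℝ) ^ s := by
        rw [Real.mul_rpow hv0.le (by positivity), ← Real.rpow_natCast, ← Real.rpow_mul hm'.le,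
          mul_div_cancel₀ _ hd'.ne']
  calc a * v ^ (-(s / d)) * (ω.card : ℝ) ^ (1 + s / d) - T.card * ((m : ℝ) ^ s * C)
      ≤ a * v ^ (-(s / d)) * ((v ^ (s / d) * (m : ℝ) ^ s) *
      ∑ k ∈ T, ((ω.filter (gridIndex m · = k)).card : ℝ) ^ (1 + s / d)) -
        T.card * ((m : ℝ) ^ s * C) := by gcongr
    _ = ∑ k ∈ T, (m : ℝ) ^ s *
        (a * ((ω.filter (gridIndex m · = k)).card : ℝ) ^ (1 + s / d) - C) := by
      rw [← Finset.mul_sum, Finset.sum_sub_distrib, ← Finset.mul_sum, Finset.sum_const,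
        nsmul_eq_mul, Real.rpow_neg hv0.le]
      field_simp
    _ ≤ ∑ k ∈ T, rieszEnergy s (ω.filter (gridIndex m · = k)) := by
      refine Finset.sum_le_sum fun k _ => mul_le_rieszEnergy_of_gridIndex_eq hm
        (fun x hx => (Finset.mem_filter.1 hx).2) fun ω' h1 h2 => ?_
      rw [← h2]
      exact hU ω' h1
    _ ≤ rieszEnergy s ω := sum_rieszEnergy_fiber_le _ _ _

lemma isBounded_unitCube (d : ℕ) : Bornology.IsBounded (unitCube d) := by
  refine isBounded_iff_forall_norm_le.2 ⟨√d, fun x hx => ?_⟩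
  rw [EuclideanSpace.norm_eq]
  refine Real.sqrt_le_sqrt ?_
  calc ∑ i, ‖x i‖ ^ 2 ≤ ∑ _i : Fin d, (1 : ℝ) := by
        refine Finset.sum_le_sum fun i _ => ?_
        have := hx i
        rw [Real.norm_of_nonneg this.1]
        exact pow_le_one₀ this.1 this.2
    _ = d := by simp

lemma isClosed_unitCube (d : ℕ) : IsClosed (unitCube d) := by
  have : unitCube d = ⋂ i, {x | x i ∈ Set.Icc (0 : ℝ) 1} := by ext; simp [unitCube]
  rw [this]
  exact isClosed_iInter fun i => isClosed_Icc.preimage (by fun_prop)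

lemma volume_unitCube (d : ℕ) : volume (unitCube d) = 1 := by
  have : unitCube d = (MeasurableEquiv.toLp 2 (Fin d → ℝ)).symm ⁻¹'
      (Set.univ.pi fun _ => Set.Icc (0 : ℝ) 1) := by
    ext
    simp [unitCube, Pi.le_def, forall_and]
  rw [this,
    (EuclideanSpace.volume_preserving_symm_measurableEquiv_toLp (Fin d)).measure_preimage_equiv]
  simp [Real.volume_Icc_pi]

lemma isAlmostClopen_unitCube (d : ℕ) : IsAlmostClopen (unitCube d) := by
  refine ⟨(isClosed_unitCube d).measurableSet.nullMeasurableSet, Convex.addHaar_frontier _ ?_⟩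
  intro x hx y hy a b ha hb hab i
  simp only [PiLp.add_apply, PiLp.smul_apply]
  exact convex_Icc (0 : ℝ) 1 (hx i) (hy i) ha hb hab

lemma rieszTau_of_lt (h : (d : ℝ) < s) (N : ℕ) : rieszTau s d N = (N : ℝ) ^ (1 + s / d) := by
  rw [rieszTau, if_neg h.ne']

/-- The minimal energy over the unit cube is at least of order `N ^ (1 + s / d)`. -/
lemma exists_pos_eventually_le_rieszEnergy (hd : 0 < d) (hs : 0 ≤ s) :
    ∃ c : ℝ, 0 < c ∧ ∀ᶠ N : ℕ in atTop, ∀ ω : Finset (EuclideanSpace ℝ (Fin d)),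
      ↑ω ⊆ unitCube d → ω.card = N → c * (N : ℝ) ^ (1 + s / d) ≤ rieszEnergy s ω := by
  classical
  have hd' : (0 : ℝ) < d := by exact_mod_cast hd
  have hcov := eventually_exists_gridIndex_cover (isBounded_unitCube d) (v := 2) (by
    rw [(isClosed_unitCube d).closure_eq, volume_unitCube]; norm_num)
  have hx : Tendsto (fun N : ℕ => ((N : ℝ) / 4) ^ (1 / (d : ℝ))) atTop atTop :=
    (tendsto_rpow_atTop (by positivity)).comp
      (tendsto_natCast_atTop_atTop.atTop_div_const (by norm_num))
  have hm : Tendsto (fun N : ℕ => ⌊((N : ℝ) / 4) ^ (1 / (d : ℝ))⌋₊) atTop atTop :=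
    tendsto_nat_floor_atTop.comp hx
  -- Take m = ⌊x⌋ with x = (N/4)^(1/d): at most 2 m^d ≤ N/2 cells are occupied, so the excess of
  -- points over cells is at least N/2. Each excess point costs (m/d)^s, and m ≥ x/2.
  refine ⟨1 / 2 * (1 / (2 * d) * (1 / 4) ^ (1 / (d : ℝ))) ^ s, by positivity, ?_⟩
  filter_upwards [hm.eventually hcov, hx.eventually_ge_atTop 1] with N ⟨T, hT, hTc⟩ hN1 ω hω hN
  set x := ((N : ℝ) / 4) ^ (1 / (d : ℝ)) with hxdef
  set m := ⌊x⌋₊ with hmdef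
  have hN0 : (0 : ℝ) ≤ (N : ℝ) := Nat.cast_nonneg N
  have hm1 : 1 ≤ m := (Nat.one_le_floor_iff x).2 hN1
  have hm' : (0 : ℝ) < m := by exact_mod_cast hm1
  have hmx : (m : ℝ) ≤ x := Nat.floor_le (by linarith)
  have hxm : x / 2 ≤ m := by
    have h1 : x < m + 1 := Nat.lt_floor_add_one x
    have h2 : (1 : ℝ) ≤ m := by exact_mod_cast hm1
    linarith
  have hxd : x ^ d = N / 4 := by
    rw [hxdef, ← Real.rpow_natCast, ← Real.rpow_mul (by positivity), one_div_mul_cancel hd'.ne',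
      Real.rpow_one]
  have hTN : (T.card : ℝ) ≤ N / 2 := by
    calc (T.card : ℝ) ≤ 2 * (m : ℝ) ^ d := hTc
      _ ≤ 2 * x ^ d := by gcongr
      _ = N / 2 := by rw [hxd]; ring
  have hcard : (N : ℝ) = ∑ k ∈ T, ((ω.filter (gridIndex m · = k)).card : ℝ) := by
    rw [← hN]
    exact_mod_cast Finset.card_eq_sum_card_fiberwise fun x hx => hT x (hω hx)
  calc 1 / 2 * (1 / (2 * d) * (1 / 4) ^ (1 / (d : ℝ))) ^ s * (N : ℝ) ^ (1 + s / d)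
      = N / 2 * (x / 2 / d) ^ s := by
        have hNpos : (0 : ℝ) < N := by
          rcases hN0.eq_or_lt with h | h
          · rw [hxdef, ← h, zero_div, Real.zero_rpow (by positivity)] at hN1
            linarith
          · exact h
        have : x / 2 / d = (1 / (2 * d) * (1 / 4) ^ (1 / (d : ℝ))) * (N : ℝ) ^ (1 / (d : ℝ)) := by
          rw [hxdef, div_eq_mul_one_div (N : ℝ) 4, Real.mul_rpow hN0 (by norm_num)]
          field_simp
        rw [this, Real.mul_rpow (y := (N : ℝ) ^ (1 / (d : ℝ))) (by positivity) (by positivity),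
          ← Real.rpow_mul hN0,
          Real.rpow_add hNpos, Real.rpow_one, one_div_mul_eq_div]
        ring_nf
    _ ≤ N / 2 * (m / d) ^ s := by gcongr
    _ ≤ (N - T.card) * (m / d) ^ s := by gcongr; linarith
    _ = ∑ k ∈ T, (((ω.filter (gridIndex m · = k)).card : ℝ) - 1) * (1 / (d / m : ℝ) ^ s) := by
      rw [← Finset.sum_mul, Finset.sum_sub_distrib, ← hcard, Finset.sum_const, nsmul_eq_mul,
        mul_one, one_div, ← Real.inv_rpow (by positivity), inv_div]
    _ ≤ ∑ k ∈ T, rieszEnergy s (ω.filter (gridIndex m · = k)) := by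
      refine Finset.sum_le_sum fun k _ => card_sub_one_mul_le_rieszEnergy hs (by positivity) _
        fun x hx y hy => norm_sub_le_of_gridIndex_eq hm1 ?_
      rw [(Finset.mem_filter.1 hx).2, (Finset.mem_filter.1 hy).2]
    _ ≤ rieszEnergy s ω := sum_rieszEnergy_fiber_le _ _ _

end LowerBound

/-! ### Upper bounds by contracted copies in cells -/

section UpperBound

variable {d : ℕ} {s : ℝ}

/-- For s ≠ 0 the diagonal terms are 1 / 0 ^ s = 0 by convention, so the full double sum may be
used. -/
lemma rieszEnergy_eq_sum_sum (hs : s ≠ 0) (ω : Finset (EuclideanSpace ℝ (Fin d))) :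
    rieszEnergy s ω = ∑ x ∈ ω, ∑ y ∈ ω, 1 / ‖x - y‖ ^ s := by
  classical
  rw [← Finset.sum_product', ← Finset.diag_union_offDiag,
    Finset.sum_union (Finset.disjoint_diag_offDiag ω), Finset.sum_diag]
  simp only [sub_self, norm_zero, Real.zero_rpow hs, div_zero, Finset.sum_const_zero, zero_add]
  unfold rieszEnergy
  exact Finset.sum_congr (by congr) fun _ _ => rfl

lemma summable_one_div_norm_rpow_int (h : (d : ℝ) < s) :
    Summable fun k : Fin d → ℤ => 1 / ‖k‖ ^ s := by
  set L := Submodule.span ℤ (Set.range (Pi.basisFun ℝ (Fin d))) with hL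
  have hr : Module.finrank ℤ L = d := by
    rw [ZLattice.rank ℝ L]; simp
  have hmem : ∀ k : Fin d → ℤ, (fun i => (k i : ℝ)) ∈ L := fun k => by
    have : (fun i => (k i : ℝ)) = ∑ i, k i • Pi.basisFun ℝ (Fin d) i := by
      ext j
      simp [Finset.sum_apply, Pi.single_apply]
    rw [this]
    exact Submodule.sum_mem _ fun i _ => Submodule.smul_mem _ _
      (Submodule.subset_span (Set.mem_range_self i))
  have hsum := ZLattice.summable_norm_rpow L (-s) (by rw [hr]; linarith)
  have hinj : Function.Injective fun k : Fin d → ℤ => (⟨fun i => (k i : ℝ), hmem k⟩ : L) := by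
    intro k l hkl
    ext i
    have : (k i : ℝ) = l i := congrFun (congrArg Subtype.val hkl) i
    exact_mod_cast this
  refine (hsum.comp_injective hinj).congr fun k => ?_
  have hn : ‖(⟨fun i => (k i : ℝ), hmem k⟩ : L)‖ = ‖k‖ := by
    rw [Submodule.coe_norm, Pi.norm_def, Pi.norm_def]
    rfl
  simp only [Function.comp]
  rw [hn, Real.rpow_neg (norm_nonneg _), one_div]

/-- By translation, every such sum is part of one lattice sum, which converges precisely because s >
d; the bound is uniform in S and k. -/
lemma exists_sum_one_div_norm_sub_rpow_le (h : (d : ℝ) < s) :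
    ∃ C : ℝ, 0 ≤ C ∧ ∀ (S : Finset (Fin d → ℤ)) (k : Fin d → ℤ),
      ∑ l ∈ S, 1 / ‖k - l‖ ^ s ≤ C := by
  classical
  refine ⟨∑' k : Fin d → ℤ, 1 / ‖k‖ ^ s, tsum_nonneg fun _ => by positivity, fun S k => ?_⟩
  have := (summable_one_div_norm_rpow_int h).sum_le_tsum (S.image (k - ·))
    fun _ _ => by positivity
  rwa [Finset.sum_image fun _ _ _ _ h => sub_right_injective h] at this

/-- The point of the grid cube with index `k` corresponding to the point `y` of the unit cube,
contracted by the factor `γ`. -/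
def gridPoint (m : ℕ) (γ : ℝ) (k : Fin d → ℤ) (y : EuclideanSpace ℝ (Fin d)) :
    EuclideanSpace ℝ (Fin d) := WithLp.toLp 2 fun i => ((k i : ℝ) + γ * y i) / m

lemma gridIndex_gridPoint {m : ℕ} (hm : 0 < m) {γ : ℝ} (h0 : 0 < γ) (h1 : γ < 1)
    (k : Fin d → ℤ) {y : EuclideanSpace ℝ (Fin d)} (hy : y ∈ unitCube d) :
    gridIndex m (gridPoint m γ k y) = k := by
  have hm' : (m : ℝ) ≠ 0 := by positivity
  refine gridIndex_eq_iff.2 fun i => ?_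
  have := hy i
  simp only [gridPoint, mul_div_cancel₀ _ hm']
  constructor <;> nlinarith [this.1, this.2]

lemma norm_gridPoint_sub_self {m : ℕ} {γ : ℝ} (h0 : 0 < γ)
    (k : Fin d → ℤ) (y z : EuclideanSpace ℝ (Fin d)) :
    ‖gridPoint m γ k y - gridPoint m γ k z‖ = γ / m * ‖y - z‖ := by
  have : gridPoint m γ k y - gridPoint m γ k z = (γ / m) • (y - z) := by
    ext i
    simp [gridPoint]
    ring
  rw [this, norm_smul, Real.norm_of_nonneg (by positivity)]

/-- Coordinatewise: if the integers k i and l i differ, then |k i - l i| ≥ 1, and the contracted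
offsets change the difference by at most γ ≤ γ |k i - l i|. -/
lemma mul_norm_sub_le_norm_gridPoint_sub {m : ℕ} (hm : 0 < m) {γ : ℝ} (h0 : 0 < γ) (h1 : γ < 1)
    (k l : Fin d → ℤ) {y z : EuclideanSpace ℝ (Fin d)} (hy : y ∈ unitCube d)
    (hz : z ∈ unitCube d) :
    (1 - γ) / m * ‖k - l‖ ≤ ‖gridPoint m γ k y - gridPoint m γ l z‖ := by
  have hm' : (0 : ℝ) < m := by exact_mod_cast hm
  have hg : 0 < 1 - γ := by linarith
  rw [← le_div_iff₀' (by positivity), pi_norm_le_iff_of_nonneg (by positivity)]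
  intro i
  rw [le_div_iff₀' (by positivity)]
  refine le_trans ?_ (PiLp.norm_apply_le _ i)
  rw [Pi.sub_apply, Int.norm_eq_abs, Real.norm_eq_abs]
  have he : (gridPoint m γ k y - gridPoint m γ l z) i =
      (((k i - l i : ℤ) : ℝ) + γ * (y i - z i)) / m := by
    simp [gridPoint]; ring
  rw [he, abs_div, abs_of_pos hm', div_mul_eq_mul_div]
  gcongr
  rcases eq_or_ne (k i - l i) 0 with h | h
  · rw [h, Int.cast_zero, abs_zero, mul_zero]
    exact abs_nonneg _
  have h2 : (1 : ℝ) ≤ |((k i - l i : ℤ) : ℝ)| := by exact_mod_cast Int.one_le_abs h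
  have h3 : |γ * (y i - z i)| ≤ γ := by
    rw [abs_mul, abs_of_pos h0]
    have : |y i - z i| ≤ 1 := by
      have := hy i; have := hz i
      rw [abs_le]; constructor <;> linarith [(hy i).1, (hy i).2, (hz i).1, (hz i).2]
    nlinarith
  have h4 := abs_sub_abs_le_abs_sub (((k i - l i : ℤ) : ℝ)) (-(γ * (y i - z i)))
  rw [abs_neg, sub_neg_eq_add] at h4
  nlinarith

/-- Contracted copies of a configuration, placed in the cubes of a grid. -/
lemma exists_rieszEnergy_le_of_grid (h : (d : ℝ) < s) :
    ∃ C : ℝ, 0 ≤ C ∧ ∀ (γ : ℝ), 0 < γ → γ < 1 → ∀ ω₀ : Finset (EuclideanSpace ℝ (Fin d)),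
      ↑ω₀ ⊆ unitCube d → ∀ (A : Set (EuclideanSpace ℝ (Fin d))) (m : ℕ), 0 < m →
      ∀ S : Finset (Fin d → ℤ), (∀ x : EuclideanSpace ℝ (Fin d), gridIndex m x ∈ S → x ∈ A) →
      ∃ ω : Finset (EuclideanSpace ℝ (Fin d)), ↑ω ⊆ A ∧ ω.card = S.card * ω₀.card ∧
        rieszEnergy s ω ≤ S.card * (m : ℝ) ^ s *
          (rieszEnergy s ω₀ / γ ^ s + C * (ω₀.card : ℝ) ^ 2 / (1 - γ) ^ s) := by
  classical
  obtain ⟨C, hC0, hC⟩ := exists_sum_one_div_norm_sub_rpow_le h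
  refine ⟨C, hC0, fun γ h0 h1 ω₀ hω₀ A m hm S hS => ?_⟩
  have hs : 0 < s := (Nat.cast_nonneg d).trans_lt h
  have hm' : (0 : ℝ) < m := by exact_mod_cast hm
  have hg : 0 < 1 - γ := by linarith
  set P : (Fin d → ℤ) × EuclideanSpace ℝ (Fin d) → EuclideanSpace ℝ (Fin d) :=
    fun q => gridPoint m γ q.1 q.2 with hP
  have hidx : ∀ q ∈ S ×ˢ ω₀, gridIndex m (P q) = q.1 := fun q hq =>
    gridIndex_gridPoint hm h0 h1 _ (hω₀ (Finset.mem_product.1 hq).2)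
  have hinj : Set.InjOn P (S ×ˢ ω₀ : Finset _) := by
    rintro ⟨k, y⟩ hq ⟨l, z⟩ hr hqr
    have hkl : k = l := by
      have := hidx _ hq
      rw [hqr, hidx _ hr] at this
      exact this.symm
    subst hkl
    have h2 := norm_gridPoint_sub_self (m := m) h0 k y z
    simp only [hP] at hqr
    rw [hqr, sub_self, norm_zero, eq_comm, mul_eq_zero, or_iff_right (by positivity),
      norm_eq_zero, sub_eq_zero] at h2
    rw [h2]
  refine ⟨(S ×ˢ ω₀).image P, ?_, ?_, ?_⟩
  · intro x hx
    obtain ⟨q, hq, rfl⟩ := Finset.mem_image.1 (Finset.mem_coe.1 hx)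
    refine hS _ ?_
    rw [hidx q hq]
    exact (Finset.mem_product.1 hq).1
  · rw [Finset.card_image_of_injOn hinj, Finset.card_product]
  rw [rieszEnergy_eq_sum_sum hs.ne', Finset.sum_image hinj]
  simp only [Finset.sum_image hinj]
  -- The second summand needs no case distinction, since it is 0 when the two cells coincide.
  have hterm : ∀ q ∈ S ×ˢ ω₀, ∀ r ∈ S ×ˢ ω₀, 1 / ‖P q - P r‖ ^ s ≤
      (if q.1 = r.1 then (m : ℝ) ^ s / γ ^ s * (1 / ‖q.2 - r.2‖ ^ s) else 0) +
        (m : ℝ) ^ s / (1 - γ) ^ s * (1 / ‖q.1 - r.1‖ ^ s) := by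
    rintro ⟨k, y⟩ hq ⟨l, z⟩ hr
    simp only
    split_ifs with hkl
    · subst hkl
      simp only [hP, norm_gridPoint_sub_self h0, sub_self, norm_zero, Real.zero_rpow hs.ne',
        div_zero, mul_zero, add_zero]
      rw [Real.mul_rpow (by positivity) (by positivity), Real.div_rpow h0.le hm'.le, one_div,
        one_div, mul_inv, inv_div]
    · have hpos : 0 < ‖k - l‖ := norm_pos_iff.2 (sub_ne_zero.2 hkl)
      have h2 := mul_norm_sub_le_norm_gridPoint_sub hm h0 h1 k l
        (hω₀ (Finset.mem_product.1 hq).2) (hω₀ (Finset.mem_product.1 hr).2)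
      rw [zero_add]
      calc 1 / ‖P (k, y) - P (l, z)‖ ^ s ≤ 1 / ((1 - γ) / m * ‖k - l‖) ^ s := by gcongr
        _ = _ := by
          rw [Real.mul_rpow (by positivity) (by positivity), Real.div_rpow hg.le hm'.le, one_div,
            one_div, mul_inv, inv_div]
  calc ∑ q ∈ S ×ˢ ω₀, ∑ r ∈ S ×ˢ ω₀, 1 / ‖P q - P r‖ ^ s
      ≤ ∑ q ∈ S ×ˢ ω₀, ∑ r ∈ S ×ˢ ω₀,
        ((if q.1 = r.1 then (m : ℝ) ^ s / γ ^ s * (1 / ‖q.2 - r.2‖ ^ s) else 0) +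
          (m : ℝ) ^ s / (1 - γ) ^ s * (1 / ‖q.1 - r.1‖ ^ s)) :=
        Finset.sum_le_sum fun q hq => Finset.sum_le_sum fun r hr => hterm q hq r hr
    _ = S.card * ((m : ℝ) ^ s / γ ^ s * rieszEnergy s ω₀) + (ω₀.card : ℝ) ^ 2 *
          ((m : ℝ) ^ s / (1 - γ) ^ s * ∑ k ∈ S, ∑ l ∈ S, 1 / ‖k - l‖ ^ s) := by
      simp only [Finset.sum_add_distrib]
      congr 1
      · simp only [Finset.sum_product]
        rw [rieszEnergy_eq_sum_sum hs.ne', ← nsmul_eq_mul, ← Finset.sum_const]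
        refine Finset.sum_congr rfl fun k hk => ?_
        rw [Finset.mul_sum]
        refine Finset.sum_congr rfl fun y _ => ?_
        rw [Finset.sum_comm, Finset.mul_sum]
        refine Finset.sum_congr rfl fun z _ => ?_
        rw [Finset.sum_ite_eq, if_pos hk]
      · simp only [Finset.sum_product, Finset.sum_const, nsmul_eq_mul, ← Finset.mul_sum]
        ring
    _ ≤ S.card * ((m : ℝ) ^ s / γ ^ s * rieszEnergy s ω₀) + (ω₀.card : ℝ) ^ 2 *
          ((m : ℝ) ^ s / (1 - γ) ^ s * (S.card * C)) := by
      gcongr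
      refine (Finset.sum_le_sum fun k _ => hC S k).trans ?_
      rw [Finset.sum_const, nsmul_eq_mul]
    _ = _ := by ring

/-- Asymptotics of the energy of configurations built from about `N / N₀` cubes, with `N₀` points
in each of them. -/
lemma eventually_exists_rieszEnergy_le (hd : 0 < d) (hs : 0 ≤ s) {N₀ : ℕ} (hN₀ : 0 < N₀) {D : ℝ}
    (hD : 0 ≤ D) {A : Set (EuclideanSpace ℝ (Fin d))} (hA : Bornology.IsBounded A)
    (hA' : volume (frontier A) = 0)
    (H : ∀ m : ℕ, 0 < m → ∀ S : Finset (Fin d → ℤ),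
      (∀ x : EuclideanSpace ℝ (Fin d), gridIndex m x ∈ S → x ∈ A) →
      ∃ ω : Finset (EuclideanSpace ℝ (Fin d)), ↑ω ⊆ A ∧ ω.card = S.card * N₀ ∧
        rieszEnergy s ω ≤ S.card * (m : ℝ) ^ s * D)
    {v c : ℝ} (hv0 : 0 < v) (hv : ENNReal.ofReal v < volume A)
    (hc : D / (N₀ : ℝ) ^ (1 + s / d) < c) :
    ∀ᶠ N : ℕ in atTop, ∃ ω : Finset (EuclideanSpace ℝ (Fin d)), ↑ω ⊆ A ∧ N ≤ ω.card ∧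
      rieszEnergy s ω ≤ c * v ^ (-(s / d)) * (N : ℝ) ^ (1 + s / d) := by
  have hd' : (0 : ℝ) < d := by exact_mod_cast hd
  have hN₀' : (0 : ℝ) < N₀ := by exact_mod_cast hN₀
  -- Chosen so that v x^d = N/N₀ + 1 ≥ ⌈N/N₀⌉: with m = ⌈x⌉ the packing supplies enough cells for N
  -- points.
  set x : ℕ → ℝ := fun N => (((N : ℝ) / N₀ + 1) / v) ^ (1 / (d : ℝ)) with hx
  have hx0 : ∀ N, 0 < x N := fun N => by positivity
  have hxt : Tendsto x atTop atTop :=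
    (tendsto_rpow_atTop (by positivity)).comp ((tendsto_atTop_add_const_right _ _
      (tendsto_natCast_atTop_atTop.atTop_div_const hN₀')).atTop_div_const hv0)
  have hmt : Tendsto (fun N => ⌈x N⌉₊) atTop atTop := tendsto_nat_ceil_atTop.comp hxt
  have h1 : Tendsto (fun N : ℕ => ((N : ℝ) / N₀ + 1) / N) atTop (𝓝 (1 / N₀)) := by
    have : Tendsto (fun N : ℕ => 1 / (N₀ : ℝ) + 1 / (N : ℝ)) atTop (𝓝 (1 / N₀ + 0)) :=
      tendsto_const_nhds.add tendsto_one_div_atTop_nhds_zero_nat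
    rw [add_zero] at this
    refine this.congr' ?_
    filter_upwards [eventually_gt_atTop 0] with N hN
    have : (N : ℝ) ≠ 0 := by positivity
    field_simp
  have h2 : Tendsto (fun N : ℕ => (x N + 1) / (N : ℝ) ^ (1 / (d : ℝ))) atTop
      (𝓝 ((1 / N₀ / v) ^ (1 / (d : ℝ)))) := by
    have h3 : Tendsto (fun N : ℕ => (((N : ℝ) / N₀ + 1) / N / v) ^ (1 / (d : ℝ)) +
        1 / (N : ℝ) ^ (1 / (d : ℝ))) atTop (𝓝 ((1 / N₀ / v) ^ (1 / (d : ℝ)) + 0)) := by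
      refine ((h1.div_const v).rpow_const (Or.inr (by positivity))).add ?_
      exact tendsto_const_nhds.div_atTop
        ((tendsto_rpow_atTop (by positivity)).comp tendsto_natCast_atTop_atTop)
    rw [add_zero] at h3
    refine h3.congr' ?_
    filter_upwards [eventually_gt_atTop 0] with N hN
    have hN' : (0 : ℝ) < N := by exact_mod_cast hN
    rw [add_div (x N), ← Real.div_rpow (by positivity) (by positivity), div_right_comm]
  have h4 : Tendsto (fun N : ℕ => ((N : ℝ) / N₀ + 1) / N *
      ((x N + 1) / (N : ℝ) ^ (1 / (d : ℝ))) ^ s * D) atTop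
      (𝓝 (1 / N₀ * ((1 / N₀ / v) ^ (1 / (d : ℝ))) ^ s * D)) :=
    (h1.mul (h2.rpow_const (Or.inr hs))).mul_const D
  have h5 : 1 / N₀ * ((1 / N₀ / v) ^ (1 / (d : ℝ))) ^ s * D < c * v ^ (-(s / d)) := by
    have : 1 / N₀ * ((1 / N₀ / v) ^ (1 / (d : ℝ))) ^ s * D =
        D / (N₀ : ℝ) ^ (1 + s / d) * v ^ (-(s / d)) := by
      rw [← Real.rpow_mul (by positivity), one_div_mul_eq_div, Real.div_rpow (by positivity) hv0.le,
        Real.rpow_neg hv0.le, Real.rpow_add hN₀', Real.rpow_one, one_div, Real.inv_rpow hN₀'.le]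
      field_simp
    rw [this]
    gcongr
  filter_upwards [h4.eventually_le_const h5, eventually_gt_atTop 0,
    hmt.eventually (eventually_exists_gridIndex_packing hA hA' hv)] with N hN hN0 ⟨S, hS, hSc⟩
  have hN' : (0 : ℝ) < N := by exact_mod_cast hN0
  set m := ⌈x N⌉₊
  have hxm : x N ≤ m := Nat.le_ceil _
  have hm0 : 0 < m := Nat.ceil_pos.2 (hx0 N)
  have hM : ⌈(N : ℝ) / N₀⌉₊ ≤ S.card := by
    have h6 : (⌈(N : ℝ) / N₀⌉₊ : ℝ) ≤ S.card := by
      calc (⌈(N : ℝ) / N₀⌉₊ : ℝ) ≤ (N : ℝ) / N₀ + 1 := (Nat.ceil_lt_add_one (by positivity)).le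
        _ = v * x N ^ d := by
          rw [hx, ← Real.rpow_natCast, ← Real.rpow_mul (by positivity),
            one_div_mul_cancel hd'.ne', Real.rpow_one, mul_div_cancel₀ _ hv0.ne']
        _ ≤ v * (m : ℝ) ^ d := by have := (hx0 N).le; gcongr
        _ ≤ S.card := hSc
    exact_mod_cast h6
  -- Only ⌈N/N₀⌉ of the packed cells are filled, so that the energy is controlled by N rather than
  -- by the number of cells available.
  obtain ⟨S', hS', hS'c⟩ := Finset.exists_subset_card_eq hM
  obtain ⟨ω, hω1, hω2, hω3⟩ := H m hm0 S' fun x hx => hS x (hS' hx)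
  refine ⟨ω, hω1, ?_, ?_⟩
  · have h6 : (N : ℝ) ≤ ω.card := by
      rw [hω2, hS'c]
      push_cast
      rw [← div_le_iff₀ hN₀']
      exact Nat.le_ceil _
    exact_mod_cast h6
  · have h7 : (⌈(N : ℝ) / N₀⌉₊ : ℝ) ≤ (N : ℝ) / N₀ + 1 :=
      (Nat.ceil_lt_add_one (by positivity)).le
    have h8 : (m : ℝ) ≤ x N + 1 := (Nat.ceil_lt_add_one (hx0 N).le).le
    have hx1 := (hx0 N).le
    calc rieszEnergy s ω ≤ (⌈(N : ℝ) / N₀⌉₊ : ℝ) * (m : ℝ) ^ s * D := by rwa [hS'c] at hω3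
      _ ≤ ((N : ℝ) / N₀ + 1) * (x N + 1) ^ s * D := by gcongr
      _ = ((N : ℝ) / N₀ + 1) / N * ((x N + 1) / (N : ℝ) ^ (1 / (d : ℝ))) ^ s * D *
          (N : ℝ) ^ (1 + s / d) := by
        rw [Real.div_rpow (by positivity) (by positivity), ← Real.rpow_mul hN'.le,
          one_div_mul_eq_div, Real.rpow_add hN', Real.rpow_one]
        field_simp
      _ ≤ _ := by gcongr

end UpperBound

/-! ### The case s > d -/

section Supercritical

variable {d : ℕ} {s : ℝ}

lemma volume_closure_eq_of_frontier {A : Set (EuclideanSpace ℝ (Fin d))} (hA' : volume (frontier A) = 0) :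
    volume (closure A) = volume A := by
  refine le_antisymm ?_ (measure_mono subset_closure)
  rw [closure_eq_self_union_frontier]
  exact (measure_union_le _ _).trans_eq (by rw [hA', add_zero])

lemma rieszTau_pos_of_lt (h : (d : ℝ) < s) {N : ℕ} (hN : 0 < N) : 0 < rieszTau s d N := by
  rw [rieszTau_of_lt h]; positivity

lemma liminf_normRieszEnergy_unitCube_pos (hd : 0 < d) (h : (d : ℝ) < s) :
    0 < liminf (fun N => normRieszEnergy s d (unitCube d) N) atTop := by
  obtain ⟨c, hc, hN⟩ := exists_pos_eventually_le_rieszEnergy hd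
    ((Nat.cast_nonneg d).trans h.le)
  refine (ENNReal.ofReal_pos.2 hc).trans_le (le_liminf_of_le (by isBoundedDefault) ?_)
  filter_upwards [hN, eventually_gt_atTop 0] with N hN hN0
  refine le_normRieszEnergy (rieszTau_pos_of_lt h hN0) ?_
  rwa [rieszTau_of_lt h]

/-- One point per cell suffices: a singleton has no energy of its own, so only the lattice sum
contributes. -/
lemma liminf_normRieszEnergy_unitCube_lt_top (hd : 0 < d) (h : (d : ℝ) < s) :
    liminf (fun N => normRieszEnergy s d (unitCube d) N) atTop < ∞ := by
  classical
  have hs : 0 ≤ s := (Nat.cast_nonneg d).trans h.le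
  obtain ⟨C, hC0, hC⟩ := exists_rieszEnergy_le_of_grid h
  have hev := eventually_exists_rieszEnergy_le hd hs (N₀ := 1) one_pos
    (D := C / (1 - 1 / 2) ^ s) (c := C / (1 - 1 / 2) ^ s + 1) (v := 1 / 2)
    (by positivity) (isBounded_unitCube d) (isAlmostClopen_unitCube d).2 (fun m hm S hS => by
      obtain ⟨ω, h1, h2, h3⟩ := hC (1 / 2) (by norm_num) (by norm_num) {0} (by
        intro x hx i
        simp only [Finset.coe_singleton, Set.mem_singleton_iff] at hx
        simp [hx]) (unitCube d) m hm S hS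
      refine ⟨ω, h1, by simpa using h2, ?_⟩
      simpa [rieszEnergy] using h3) (by norm_num)
    (by rw [volume_unitCube, ENNReal.ofReal_lt_one]; norm_num) (by simp)
  refine lt_of_le_of_lt (liminf_le_of_frequently_le' ?_)
    (ENNReal.ofReal_lt_top (r := (C / (1 - 1 / 2) ^ s + 1) * (1 / 2) ^ (-(s / d))))
  refine Eventually.frequently ?_
  filter_upwards [hev, eventually_gt_atTop 0] with N ⟨ω, h1, h2, h3⟩ hN
  refine normRieszEnergy_le (rieszTau_pos_of_lt h hN) h1 h2 ?_
  rwa [rieszTau_of_lt h]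

/-- A single near-optimal N₀ for the cube controls all large N for A. This is why the liminf, not
the limsup, is the right constant. -/
lemma eventually_normRieszEnergy_le (hd : 0 < d) (h : (d : ℝ) < s)
    {A : Set (EuclideanSpace ℝ (Fin d))} (hA : Bornology.IsBounded A)
    (hA' : volume (frontier A) = 0) {a v : ℝ}
    (ha : liminf (fun N => normRieszEnergy s d (unitCube d) N) atTop < ENNReal.ofReal a)
    (hv0 : 0 < v) (hv : ENNReal.ofReal v < volume A) :
    ∀ᶠ N in atTop, normRieszEnergy s d A N ≤ ENNReal.ofReal (a * v ^ (-(s / d))) := by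
  have hd' : (0 : ℝ) < d := by exact_mod_cast hd
  have hs : 0 ≤ s := (Nat.cast_nonneg d).trans h.le
  obtain ⟨C, hC0, hC⟩ := exists_rieszEnergy_le_of_grid h
  obtain ⟨b, hb, hb'⟩ := exists_between ha
  have hbt : b ≠ ∞ := (hb'.trans ENNReal.ofReal_lt_top).ne
  set a₁ := b.toReal with ha₁
  have hba : b = ENNReal.ofReal a₁ := (ENNReal.ofReal_toReal hbt).symm
  rw [hba] at hb hb'
  have ha₁a : a₁ < a := (ENNReal.ofReal_lt_ofReal_iff'.1 hb').1
  -- Contraction by γ inflates the energy by γ^(-s); take γ close enough to 1 to stay below a.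
  obtain ⟨γ, hγ, h0, h1⟩ : ∃ γ : ℝ, a₁ / γ ^ s < a ∧ 0 < γ ∧ γ < 1 := by
    have hcont : Tendsto (fun γ : ℝ => a₁ / γ ^ s) (𝓝[<] 1) (𝓝 (a₁ / 1 ^ s)) := by
      refine (ContinuousAt.tendsto ?_).mono_left nhdsWithin_le_nhds
      exact continuousAt_const.div (Real.continuousAt_rpow_const _ _ (Or.inl one_ne_zero))
        (by simp)
    rw [Real.one_rpow, div_one] at hcont
    exact ((hcont.eventually_lt_const ha₁a).and (Ioo_mem_nhdsLT one_pos)).exists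
  -- With γ fixed, the cross term N² / N^(1+s/d) tends to 0 because s/d > 1.
  have hlim : Tendsto (fun N : ℕ => a₁ / γ ^ s + C / (1 - γ) ^ s * (N : ℝ) ^ (-(s / d - 1)))
      atTop (𝓝 (a₁ / γ ^ s + C / (1 - γ) ^ s * 0)) := by
    refine tendsto_const_nhds.add (tendsto_const_nhds.mul ?_)
    refine (tendsto_rpow_neg_atTop ?_).comp tendsto_natCast_atTop_atTop
    rw [sub_pos, lt_div_iff₀ hd']; linarith
  rw [mul_zero, add_zero] at hlim
  obtain ⟨N₀, hlt, hN₀a, hN₀⟩ := ((frequently_lt_of_liminf_lt (by isBoundedDefault) hb).and_eventually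
    ((hlim.eventually_lt_const hγ).and (eventually_gt_atTop 0))).exists
  have hN₀' : (0 : ℝ) < N₀ := by exact_mod_cast hN₀
  obtain ⟨ω₀, hω₀, hcard, hE⟩ := exists_rieszEnergy_lt (rieszTau_pos_of_lt h hN₀) hlt
  rw [rieszTau_of_lt h] at hE
  have hg : 0 < 1 - γ := by linarith
  have hev := eventually_exists_rieszEnergy_le hd hs hN₀
    (D := rieszEnergy s ω₀ / γ ^ s + C * (N₀ : ℝ) ^ 2 / (1 - γ) ^ s) (c := a)
    (by have := rieszEnergy_nonneg s ω₀; positivity) hA hA' (fun m hm S hS => by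
      have := hC γ h0 h1 ω₀ hω₀ A m hm S hS
      rwa [hcard] at this) hv0 hv (by
      refine lt_of_le_of_lt ?_ hN₀a
      have h3 : (N₀ : ℝ) ^ (-(s / d - 1)) = (N₀ : ℝ) ^ 2 / (N₀ : ℝ) ^ (1 + s / d) := by
        rw [← Real.rpow_natCast, ← Real.rpow_sub hN₀']
        congr 1
        push_cast
        ring
      rw [h3, add_div]
      refine add_le_add ?_ (le_of_eq (by ring))
      rw [div_right_comm]
      gcongr
      rw [div_le_iff₀ (by positivity)]
      exact hE.le)
  filter_upwards [hev, eventually_gt_atTop 0] with N ⟨ω, h1, h2, h3⟩ hN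
  refine normRieszEnergy_le (rieszTau_pos_of_lt h hN) h1 h2 ?_
  rwa [rieszTau_of_lt h]

lemma eventually_le_normRieszEnergy (hd : 0 < d) (h : (d : ℝ) < s)
    {A : Set (EuclideanSpace ℝ (Fin d))} (hA : Bornology.IsBounded A)
    {a v : ℝ} (ha0 : 0 < a)
    (ha : ENNReal.ofReal a < liminf (fun N => normRieszEnergy s d (unitCube d) N) atTop)
    (hv : volume (closure A) < ENNReal.ofReal v) :
    ∀ᶠ N in atTop, ENNReal.ofReal (a * v ^ (-(s / d))) ≤ normRieszEnergy s d A N := by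
  have hd' : (0 : ℝ) < d := by exact_mod_cast hd
  have hs : 0 < s := hd'.trans h
  have hp : 0 < s / d := by positivity
  obtain ⟨n₀, hn₀⟩ := eventually_atTop.1 (eventually_lt_of_lt_liminf ha)
  -- Subtracting a n₀^(1+s/d) makes the bound trivial below n₀ points, so it applies to every cell
  -- however few points it holds.
  have hU : ∀ ω : Finset (EuclideanSpace ℝ (Fin d)), ↑ω ⊆ unitCube d →
      a * (ω.card : ℝ) ^ (1 + s / d) - a * (n₀ : ℝ) ^ (1 + s / d) ≤ rieszEnergy s ω := by
    intro ω hω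
    rcases le_total ω.card n₀ with hle | hle
    · refine le_trans ?_ (rieszEnergy_nonneg s ω)
      rw [sub_nonpos]
      gcongr
    · rcases Nat.eq_zero_or_pos ω.card with h0 | h0
      · have : n₀ = 0 := by omega
        rw [h0, this, sub_self]
        exact rieszEnergy_nonneg s ω
      by_contra! hlt
      have hτ := rieszTau_pos_of_lt (s := s) (d := d) h h0
      have h1 := (hn₀ _ hle).trans_le (normRieszEnergy_le (a := a) hτ hω le_rfl (by
        rw [rieszTau_of_lt h]
        have : 0 ≤ a * (n₀ : ℝ) ^ (1 + s / d) := by positivity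
        linarith))
      exact lt_irrefl _ h1
  -- A volume u strictly between that of the closure and v leaves room, of order N^(1+s/d), to
  -- absorb the additive constant C'.
  obtain ⟨b, hb, hb'⟩ := exists_between hv
  have hbt : b ≠ ∞ := (hb'.trans ENNReal.ofReal_lt_top).ne
  have hb0 : b ≠ 0 := ((zero_le (a := volume (closure A))).trans_lt hb).ne'
  rw [← ENNReal.ofReal_toReal hbt] at hb hb'
  have hbpos := ENNReal.toReal_pos hb0 hbt
  set u := b.toReal
  have huv : u < v := (ENNReal.ofReal_lt_ofReal_iff'.1 hb').1
  obtain ⟨C', hC'⟩ := exists_sub_le_rieszEnergy hd hs.le ha0.le hU hA hb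
  have hlt : a * v ^ (-(s / d)) < a * u ^ (-(s / d)) :=
    mul_lt_mul_of_pos_left (Real.rpow_lt_rpow_of_neg hbpos huv (neg_neg_of_pos hp)) ha0
  have hlim : Tendsto (fun N : ℕ => (a * u ^ (-(s / d)) - a * v ^ (-(s / d))) *
      (N : ℝ) ^ (1 + s / d)) atTop atTop :=
    Tendsto.const_mul_atTop (by linarith)
      ((tendsto_rpow_atTop (by positivity)).comp tendsto_natCast_atTop_atTop)
  filter_upwards [hlim.eventually_ge_atTop C', eventually_gt_atTop 0] with N hN hN0
  refine le_normRieszEnergy (rieszTau_pos_of_lt h hN0) fun ω hω hcard => ?_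
  have := hC' ω hω
  rw [rieszTau_of_lt h]
  rw [hcard] at this
  linarith

theorem exists_hasRieszLimit_of_lt (hd : 0 < d) (h : (d : ℝ) < s) :
    ∃ gU : ℝ≥0∞, 0 < gU ∧ gU < ∞ ∧
      ∀ A : Set (EuclideanSpace ℝ (Fin d)), Bornology.IsBounded A → IsAlmostClopen A →
        HasRieszLimit s d A (gU * volume A ^ (-(s / (d : ℝ)))) := by
  have hd' : (0 : ℝ) < d := by exact_mod_cast hd
  refine ⟨_, liminf_normRieszEnergy_unitCube_pos hd h, liminf_normRieszEnergy_unitCube_lt_top hd h,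
    fun A hA hA' => ?_⟩
  refine tendsto_mul_rpow_neg_of_bounds (div_pos (hd'.trans h) hd')
    (liminf_normRieszEnergy_unitCube_pos hd h) (liminf_normRieszEnergy_unitCube_lt_top hd h)
    hA.measure_lt_top ?_ ?_
  · exact fun a v ha hv0 hv => eventually_normRieszEnergy_le hd h hA hA'.2 ha hv0 hv
  · intro a v ha0 ha _ hv
    rw [← volume_closure_eq_of_frontier hA'.2] at hv
    exact eventually_le_normRieszEnergy hd h hA ha0 ha hv

end Supercritical

/-! ### The case s = d: greedy upper bound -/

section CriticalUpper

variable {d : ℕ}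

/-- The volume of the unit ball of `ℝ^d`. -/
def unitBallVolume (d : ℕ) : ℝ :=
  volume.real (Metric.ball (0 : EuclideanSpace ℝ (Fin d)) 1)

lemma unitBallVolume_pos (d : ℕ) : 0 < unitBallVolume d :=
  ENNReal.toReal_pos (Metric.measure_ball_pos _ _ one_pos).ne' measure_ball_lt_top.ne

/-- The function `r ↦ r ^ (-d)`, restricted to `[ρ, R]`. -/
def shellKernel (d : ℕ) (ρ R : ℝ) : ℝ → ℝ := (Set.Icc ρ R).indicator fun r => 1 / r ^ d

lemma shellKernel_nonneg {ρ : ℝ} (hρ : 0 < ρ) (R r : ℝ) : 0 ≤ shellKernel d ρ R r :=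
  Set.indicator_nonneg (fun r hr => by have := hρ.trans_le hr.1; positivity) r

/-- The polar Jacobian turns r^(-d) into 1/r: the source of the logarithm. -/
lemma pow_mul_shellKernel (hd : 0 < d) {ρ : ℝ} (hρ : 0 < ρ) (R : ℝ) :
    (fun y => y ^ (d - 1) • shellKernel d ρ R y) = (Set.Icc ρ R).indicator fun r => r⁻¹ := by
  ext y
  by_cases hy : y ∈ Set.Icc ρ R
  · have : y ≠ 0 := (hρ.trans_le hy.1).ne'
    rw [shellKernel, Set.indicator_of_mem hy, Set.indicator_of_mem hy, smul_eq_mul]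
    obtain ⟨k, rfl⟩ : ∃ k, d = k + 1 := ⟨d - 1, by omega⟩
    rw [Nat.add_sub_cancel, pow_succ]
    field_simp
  · rw [shellKernel, Set.indicator_of_notMem hy, Set.indicator_of_notMem hy, smul_zero]

lemma integrable_shellKernel (hd : 0 < d) {ρ : ℝ} (hρ : 0 < ρ) (R : ℝ) :
    Integrable fun x : EuclideanSpace ℝ (Fin d) => shellKernel d ρ R ‖x‖ := by
  have : Nontrivial (EuclideanSpace ℝ (Fin d)) := by
    have : Nonempty (Fin d) := ⟨⟨0, hd⟩⟩
    infer_instance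
  rw [integrable_fun_norm_addHaar, finrank_euclideanSpace, Fintype.card_fin,
    pow_mul_shellKernel hd hρ]
  refine IntegrableOn.integrable_indicator ?_ measurableSet_Icc |>.integrableOn
  refine ContinuousOn.integrableOn_Icc fun y hy => ?_
  exact (continuousAt_inv₀ (hρ.trans_le hy.1).ne').continuousWithinAt

lemma integral_shellKernel (hd : 0 < d) {ρ R : ℝ} (hρ : 0 < ρ) (hR : ρ ≤ R) :
    ∫ x : EuclideanSpace ℝ (Fin d), shellKernel d ρ R ‖x‖ =
      d * unitBallVolume d * Real.log (R / ρ) := by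
  have : Nontrivial (EuclideanSpace ℝ (Fin d)) := by
    have : Nonempty (Fin d) := ⟨⟨0, hd⟩⟩
    infer_instance
  rw [integral_fun_norm_addHaar, finrank_euclideanSpace, Fintype.card_fin,
    pow_mul_shellKernel hd hρ, setIntegral_indicator measurableSet_Icc,
    Set.inter_eq_self_of_subset_right
      (show Set.Icc ρ R ⊆ Set.Ioi 0 from fun y hy => hρ.trans_le hy.1),
    integral_Icc_eq_integral_Ioc, ← intervalIntegral.integral_of_le hR,
    integral_inv_of_pos hρ (hρ.trans_le hR), nsmul_eq_mul, smul_eq_mul, unitBallVolume, mul_assoc]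

/-- Some point of `A` has small potential in the field of a given configuration. -/
lemma exists_sum_one_div_norm_sub_rpow_le_log (hd : 0 < d)
    {A : Set (EuclideanSpace ℝ (Fin d))} (hA : Bornology.IsBounded A) {v : ℝ}
    (hv0 : 0 < v) (hv : v < volume.real A) :
    ∃ K : ℝ, 0 ≤ K ∧ ∀ ω : Finset (EuclideanSpace ℝ (Fin d)), ↑ω ⊆ A → 0 < ω.card →
      ∃ x ∈ A, x ∉ ω ∧ ∑ y ∈ ω, 1 / ‖x - y‖ ^ (d : ℝ) ≤
        ω.card * (unitBallVolume d * Real.log ω.card + K) / v := by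
  have hd' : (0 : ℝ) < d := by exact_mod_cast hd
  have hβ := unitBallVolume_pos d
  -- The n balls of radius r n^(-1/d) have total volume at most `volume.real A - v`, so at least v
  -- of A remains outside them.
  set r : ℝ := ((volume.real A - v) / unitBallVolume d) ^ (1 / (d : ℝ)) with hr
  have hvA : 0 < volume.real A - v := by linarith
  have hr0 : 0 < r := by positivity
  have hrd : unitBallVolume d * r ^ d = volume.real A - v := by
    rw [hr, ← Real.rpow_natCast, ← Real.rpow_mul (by positivity), one_div_mul_cancel hd'.ne',
      Real.rpow_one, mul_div_cancel₀ _ hβ.ne']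
  obtain ⟨R₀, hR₀⟩ := hA.exists_norm_le
  set R := max r (2 * R₀) with hR
  have hrR : r ≤ R := le_max_left _ _
  have hdist : ∀ x ∈ A, ∀ y ∈ A, ‖x - y‖ ≤ R := fun x hx y hy => by
    linarith [norm_sub_le x y, hR₀ x hx, hR₀ y hy, le_max_right r (2 * R₀)]
  have hlog : 0 ≤ Real.log (R / r) := Real.log_nonneg ((one_le_div hr0).2 hrR)
  refine ⟨d * unitBallVolume d * Real.log (R / r), by positivity, fun ω hω hn => ?_⟩
  set n : ℝ := (ω.card : ℝ) with hndef
  have hn1 : 1 ≤ n := by rw [hndef]; exact_mod_cast hn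
  have hn0 : 0 < n := by linarith
  set ρ := r / n ^ (1 / (d : ℝ)) with hρ
  have hρ0 : 0 < ρ := by positivity
  have hρR : ρ ≤ R := (div_le_self hr0.le (Real.one_le_rpow hn1 (by positivity))).trans hrR
  have hρd : ρ ^ d = r ^ d / n := by
    rw [hρ, div_pow, ← Real.rpow_natCast (n ^ _), ← Real.rpow_mul hn0.le,
      one_div_mul_cancel hd'.ne', Real.rpow_one]
  set U : Set (EuclideanSpace ℝ (Fin d)) := ⋃ y ∈ ω, Metric.ball y ρ with hU
  have hUvol : volume.real U ≤ volume.real A - v := by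
    calc volume.real U ≤ ∑ y ∈ ω, volume.real (Metric.ball y ρ) :=
          measureReal_biUnion_finset_le _ _
      _ = ∑ _y ∈ ω, ρ ^ d * unitBallVolume d := by
          refine Finset.sum_congr rfl fun y _ => ?_
          rw [Measure.real, Measure.addHaar_ball_of_pos _ _ hρ0, ENNReal.toReal_mul,
            ENNReal.toReal_ofReal (by positivity), finrank_euclideanSpace, Fintype.card_fin]
          rfl
      _ = volume.real A - v := by
          rw [Finset.sum_const, nsmul_eq_mul, ← hrd, hρd, ← hndef]
          field_simp
  have hDfin : volume (A \ U) ≠ ∞ := (hA.subset Set.sdiff_subset).measure_lt_top.ne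
  have hDvol : v ≤ volume.real (A \ U) := by
    have h1 : volume.real A ≤ volume.real ((A \ U) ∪ U) := by
      refine measureReal_mono (by simp) ?_
      refine (measure_union_lt_top hDfin.lt_top ?_).ne
      refine (measure_biUnion_lt_top ω.finite_toSet fun y _ => measure_ball_lt_top)
    have h2 := h1.trans (measureReal_union_le _ _)
    linarith
  have hint : ∀ y : EuclideanSpace ℝ (Fin d), Integrable fun x => shellKernel d ρ R ‖x - y‖ :=
    fun y => (integrable_shellKernel hd hρ0 R).comp_sub_right y
  have hD0 : volume (A \ U) ≠ 0 := fun h0 => by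
    rw [Measure.real, h0] at hDvol
    simp at hDvol
    linarith
  -- Some point of the remaining set has potential at most the average. There the truncation at ρ
  -- and R is inactive, since R bounds all distances within A.
  obtain ⟨x, hx, hle⟩ := exists_le_setAverage hD0 hDfin
    (integrable_finsetSum ω fun y _ => hint y).integrableOn
  have hxρ : ∀ y ∈ ω, ρ ≤ ‖x - y‖ := fun y hy => by
    have : x ∉ U := hx.2
    simp only [hU, Set.mem_iUnion, not_exists, Metric.mem_ball, not_lt, dist_eq_norm] at this
    exact this y hy
  refine ⟨x, hx.1, fun hxω => ?_, ?_⟩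
  · have := hxρ x hxω
    rw [sub_self, norm_zero] at this
    linarith
  have hsum : ∑ y ∈ ω, 1 / ‖x - y‖ ^ (d : ℝ) = ∑ y ∈ ω, shellKernel d ρ R ‖x - y‖ := by
    refine Finset.sum_congr rfl fun y hy => ?_
    rw [shellKernel, Set.indicator_of_mem (show ‖x - y‖ ∈ Set.Icc ρ R from
      ⟨hxρ y hy, hdist x hx.1 y (hω hy)⟩), Real.rpow_natCast]
  rw [hsum]
  refine hle.trans ?_
  have hpos : ∀ z : EuclideanSpace ℝ (Fin d), 0 ≤ ∑ y ∈ ω, shellKernel d ρ R ‖z - y‖ :=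
    fun z => Finset.sum_nonneg fun y _ => shellKernel_nonneg hρ0 _ _
  have hI : ∫ z in A \ U, ∑ y ∈ ω, shellKernel d ρ R ‖z - y‖ ≤
      n * (unitBallVolume d * Real.log n + d * unitBallVolume d * Real.log (R / r)) := by
    refine (setIntegral_le_integral (integrable_finsetSum ω fun y _ => hint y)
      (Eventually.of_forall hpos)).trans_eq ?_
    rw [integral_finsetSum _ fun y _ => hint y]
    have : ∀ y : EuclideanSpace ℝ (Fin d), ∫ z, shellKernel d ρ R ‖z - y‖ =
        unitBallVolume d * Real.log n + d * unitBallVolume d * Real.log (R / r) := fun y => by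
      rw [integral_sub_right_eq_self (fun z => shellKernel d ρ R ‖z‖) y,
        integral_shellKernel hd hρ0 hρR]
      have : R / ρ = R / r * n ^ (1 / (d : ℝ)) := by rw [hρ]; field_simp
      rw [this, Real.log_mul (by positivity) (by positivity), Real.log_rpow hn0]
      field_simp
      ring
    simp only [this, Finset.sum_const, nsmul_eq_mul, ← hndef]
  rw [setAverage_eq, smul_eq_mul, inv_mul_eq_div]
  have hlogn := Real.log_nonneg hn1
  gcongr

open Classical in
lemma rieszEnergy_insert {s : ℝ} (hs : s ≠ 0) {x : EuclideanSpace ℝ (Fin d)}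
    {ω : Finset (EuclideanSpace ℝ (Fin d))} (hx : x ∉ ω) :
    rieszEnergy s (insert x ω) = rieszEnergy s ω + 2 * ∑ y ∈ ω, 1 / ‖x - y‖ ^ s := by
  rw [rieszEnergy_eq_sum_sum hs, rieszEnergy_eq_sum_sum hs, Finset.sum_insert hx]
  simp only [Finset.sum_insert hx, Finset.sum_add_distrib, sub_self, norm_zero,
    Real.zero_rpow hs, div_zero, zero_add]
  simp only [norm_sub_rev _ x]
  ring

/-- Greedy choice of points gives configurations with the optimal leading term of the energy. -/
lemma exists_rieszEnergy_le_log (hd : 0 < d)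
    {A : Set (EuclideanSpace ℝ (Fin d))} (hA : Bornology.IsBounded A) {v : ℝ}
    (hv0 : 0 < v) (hv : v < volume.real A) :
    ∃ K : ℝ, ∀ N : ℕ, ∃ ω : Finset (EuclideanSpace ℝ (Fin d)), ↑ω ⊆ A ∧ ω.card = N ∧
      rieszEnergy d ω ≤ (N : ℝ) ^ 2 * (unitBallVolume d * Real.log N + K) / v := by
  classical
  have hd' : (d : ℝ) ≠ 0 := by positivity
  have hβ := unitBallVolume_pos d
  obtain ⟨K, hK0, hK⟩ := exists_sum_one_div_norm_sub_rpow_le_log hd hA hv0 hv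
  refine ⟨K, fun N => ?_⟩
  induction N with
  | zero => exact ⟨∅, by simp, rfl, by simp [rieszEnergy]⟩
  | succ N ih =>
    obtain ⟨ω, hω, hcard, hE⟩ := ih
    rcases Nat.eq_zero_or_pos N with rfl | hN
    · obtain ⟨x, hx⟩ : A.Nonempty := by
        rw [Set.nonempty_iff_ne_empty]
        rintro rfl
        simp at hv
        linarith
      refine ⟨{x}, by simpa using hx, by simp, ?_⟩
      simp [rieszEnergy]
      positivity
    · obtain ⟨x, hxA, hxω, hx⟩ := hK ω hω (by omega)
      refine ⟨insert x ω, by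
        rw [Finset.coe_insert]; exact Set.insert_subset hxA hω, by
        rw [Finset.card_insert_of_notMem hxω, hcard], ?_⟩
      have hN' : (1 : ℝ) ≤ N := by exact_mod_cast hN
      have hlog : 0 ≤ Real.log N := Real.log_nonneg hN'
      have hlog' : Real.log N ≤ Real.log (N + 1) := Real.log_le_log (by linarith) (by linarith)
      rw [hcard] at hx
      rw [rieszEnergy_insert hd' hxω]
      push_cast
      calc rieszEnergy d ω + 2 * ∑ y ∈ ω, 1 / ‖x - y‖ ^ (d : ℝ)
          ≤ (N : ℝ) ^ 2 * (unitBallVolume d * Real.log N + K) / v +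
            2 * (N * (unitBallVolume d * Real.log N + K) / v) := by gcongr
        _ = ((N : ℝ) ^ 2 + 2 * N) * (unitBallVolume d * Real.log N + K) / v := by ring
        -- The induction closes because N² + 2N ≤ (N+1)².
        _ ≤ ((N : ℝ) + 1) ^ 2 * (unitBallVolume d * Real.log (N + 1) + K) / v := by
          gcongr
          nlinarith

lemma rieszTau_self (d N : ℕ) : rieszTau d d N = (N : ℝ) ^ 2 * Real.log N := by
  rw [rieszTau, if_pos rfl]

lemma rieszTau_self_pos {N : ℕ} (hN : 1 < N) : 0 < rieszTau d d N := by
  rw [rieszTau_self]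
  have : 0 < Real.log N := Real.log_pos (by exact_mod_cast hN)
  positivity

lemma eventually_normRieszEnergy_self_le (hd : 0 < d)
    {A : Set (EuclideanSpace ℝ (Fin d))} (hA : Bornology.IsBounded A) {a v : ℝ}
    (ha : unitBallVolume d < a) (hv0 : 0 < v) (hv : v < volume.real A) :
    ∀ᶠ N in atTop, normRieszEnergy d d A N ≤ ENNReal.ofReal (a / v) := by
  obtain ⟨K, hK⟩ := exists_rieszEnergy_le_log hd hA hv0 hv
  have hlim : Tendsto (fun N : ℕ => (a - unitBallVolume d) * Real.log N) atTop atTop :=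
    (Real.tendsto_log_atTop.comp tendsto_natCast_atTop_atTop).const_mul_atTop (by linarith)
  filter_upwards [hlim.eventually_ge_atTop K, eventually_gt_atTop 1] with N hN hN1
  obtain ⟨ω, h1, h2, h3⟩ := hK N
  refine normRieszEnergy_le (rieszTau_self_pos hN1) h1 h2.ge (h3.trans ?_)
  rw [rieszTau_self, div_mul_eq_mul_div]
  have : unitBallVolume d * Real.log N + K ≤ a * Real.log N := by linarith
  calc (N : ℝ) ^ 2 * (unitBallVolume d * Real.log N + K) / v
      ≤ (N : ℝ) ^ 2 * (a * Real.log N) / v := by gcongr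
    _ = _ := by ring

end CriticalUpper

/-! ### The case s = d: Gaussian lower bound -/

section CriticalLower

variable {d : ℕ}

lemma integral_exp_neg_mul_norm_sub_sq {b : ℝ} (hb : 0 < b) (x : EuclideanSpace ℝ (Fin d)) :
    ∫ z, Real.exp (-b * ‖z - x‖ ^ 2) = (Real.pi / b) ^ ((d : ℝ) / 2) := by
  rw [integral_sub_right_eq_self (fun z : EuclideanSpace ℝ (Fin d) => Real.exp (-b * ‖z‖ ^ 2)) x,
    GaussianFourier.integral_rexp_neg_mul_sq_norm hb, finrank_euclideanSpace, Fintype.card_fin]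

lemma integrable_exp_neg_mul_norm_sub_sq {b : ℝ} (hb : 0 < b) (x : EuclideanSpace ℝ (Fin d)) :
    Integrable fun z => Real.exp (-b * ‖z - x‖ ^ 2) := by
  refine Integrable.of_integral_ne_zero ?_
  rw [integral_exp_neg_mul_norm_sub_sq hb]
  have := Real.pi_pos
  positivity

/-- The parallelogram law about the midpoint; integrating in z exhibits exp(-t|x-y|²) as a multiple
of a convolution square. -/
lemma exp_mul_exp_eq (t : ℝ) (x y z : EuclideanSpace ℝ (Fin d)) :
    Real.exp (-(2 * t) * ‖z - x‖ ^ 2) * Real.exp (-(2 * t) * ‖z - y‖ ^ 2) =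
      Real.exp (-t * ‖x - y‖ ^ 2) * Real.exp (-(4 * t) * ‖z - midpoint ℝ x y‖ ^ 2) := by
  rw [← Real.exp_add, ← Real.exp_add]
  congr 1
  have h := parallelogram_law_with_norm ℝ (z - x) (z - y)
  have h1 : z - x + (z - y) = (2 : ℝ) • (z - midpoint ℝ x y) := by
    rw [midpoint_eq_smul_add, smul_sub, smul_smul]
    norm_num
    rw [two_smul]
    abel
  have h2 : z - x - (z - y) = -(x - y) := by abel
  rw [h1, h2, norm_neg, norm_smul, Real.norm_of_nonneg zero_le_two] at h
  linear_combination (t) * h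

/-- The mass of a Gaussian on a neighbourhood of its centre. -/
lemma mul_le_setIntegral_exp {t δ : ℝ} (ht : 0 < t) (hδ : 0 < δ)
    {x : EuclideanSpace ℝ (Fin d)} {W : Set (EuclideanSpace ℝ (Fin d))} (hW : MeasurableSet W)
    (hx : ∀ z, ‖z - x‖ < δ → z ∈ W) :
    (Real.pi / (2 * t)) ^ ((d : ℝ) / 2) * (1 - 2 ^ ((d : ℝ) / 2) * Real.exp (-t * δ ^ 2)) ≤
      ∫ z in W, Real.exp (-(2 * t) * ‖z - x‖ ^ 2) := by
  have hi := integrable_exp_neg_mul_norm_sub_sq (b := 2 * t) (by positivity) x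
  have hi' := integrable_exp_neg_mul_norm_sub_sq ht x
  have h1 := integral_add_compl hW hi
  rw [integral_exp_neg_mul_norm_sub_sq (by positivity)] at h1
  -- Outside W half of the exponent is at least tδ²; the other half remains as a Gaussian with
  -- parameter t, whose mass is 2^(d/2) times that with parameter 2t.
  have h2 : ∫ z in Wᶜ, Real.exp (-(2 * t) * ‖z - x‖ ^ 2) ≤
      Real.exp (-t * δ ^ 2) * (Real.pi / t) ^ ((d : ℝ) / 2) := by
    rw [← integral_exp_neg_mul_norm_sub_sq ht x, ← integral_const_mul]
    refine (setIntegral_mono_on hi.integrableOn (hi'.const_mul _).integrableOn hW.compl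
      fun z hz => ?_).trans
      (setIntegral_le_integral (hi'.const_mul _) (Eventually.of_forall fun z => by positivity))
    have hz' : δ ≤ ‖z - x‖ := not_lt.1 fun h => hz (hx z h)
    rw [← Real.exp_add, Real.exp_le_exp]
    have : δ ^ 2 ≤ ‖z - x‖ ^ 2 := by gcongr
    nlinarith
  have h3 : (Real.pi / t) ^ ((d : ℝ) / 2) =
      (Real.pi / (2 * t)) ^ ((d : ℝ) / 2) * 2 ^ ((d : ℝ) / 2) := by
    have := Real.pi_pos
    rw [← Real.mul_rpow (by positivity) (by positivity)]
    congr 1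
    field_simp
  rw [h3] at h2
  linarith

/-- Lower bound for Gaussian energies: the Gaussian kernel is a convolution square, and the
Cauchy–Schwarz inequality is applied on `W`. -/
lemma le_sum_sum_exp {t δ θ v : ℝ} (ht : 0 < t) (hδ : 0 < δ) (hθ : 0 ≤ θ) (hv : 0 < v)
    (hθt : θ ≤ 1 - 2 ^ ((d : ℝ) / 2) * Real.exp (-t * δ ^ 2))
    {W : Set (EuclideanSpace ℝ (Fin d))} (hW : MeasurableSet W)
    (hWv : volume W ≤ ENNReal.ofReal v)
    {ω : Finset (EuclideanSpace ℝ (Fin d))} (hω : ∀ x ∈ ω, ∀ z, ‖z - x‖ < δ → z ∈ W) :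
    (Real.pi / t) ^ ((d : ℝ) / 2) * ((ω.card : ℝ) ^ 2 * θ ^ 2 / v) ≤
      ∑ x ∈ ω, ∑ y ∈ ω, Real.exp (-t * ‖x - y‖ ^ 2) := by
  have hpi := Real.pi_pos
  set q : ℝ := (d : ℝ) / 2
  set F : EuclideanSpace ℝ (Fin d) → ℝ := fun z => ∑ x ∈ ω, Real.exp (-(2 * t) * ‖z - x‖ ^ 2)
    with hF
  have hFi : Integrable F :=
    integrable_finsetSum ω fun x _ => integrable_exp_neg_mul_norm_sub_sq (by positivity) x
  have hF2 : ∀ z, F z ^ 2 = ∑ x ∈ ω, ∑ y ∈ ω,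
      Real.exp (-t * ‖x - y‖ ^ 2) * Real.exp (-(4 * t) * ‖z - midpoint ℝ x y‖ ^ 2) := fun z => by
    rw [sq, hF, Finset.sum_mul_sum]
    simp only [exp_mul_exp_eq]
  have hi4 : ∀ x y : EuclideanSpace ℝ (Fin d), Integrable fun z =>
      Real.exp (-t * ‖x - y‖ ^ 2) * Real.exp (-(4 * t) * ‖z - midpoint ℝ x y‖ ^ 2) := fun x y =>
    (integrable_exp_neg_mul_norm_sub_sq (by positivity) _).const_mul _
  have hF2i : Integrable fun z => F z ^ 2 := by
    simp only [hF2]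
    exact integrable_finsetSum ω fun x _ => integrable_finsetSum ω fun y _ => hi4 x y
  have hF2int : ∫ z, F z ^ 2 = (Real.pi / (4 * t)) ^ q *
      ∑ x ∈ ω, ∑ y ∈ ω, Real.exp (-t * ‖x - y‖ ^ 2) := by
    simp only [hF2]
    rw [integral_finsetSum _ fun x _ => integrable_finsetSum ω fun y _ => hi4 x y, Finset.mul_sum]
    refine Finset.sum_congr rfl fun x _ => ?_
    rw [integral_finsetSum _ fun y _ => hi4 x y, Finset.mul_sum]
    refine Finset.sum_congr rfl fun y _ => ?_
    rw [integral_const_mul, integral_exp_neg_mul_norm_sub_sq (by positivity), mul_comm]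
  have hWr : volume.real W ≤ v := by
    rw [Measure.real]
    exact (ENNReal.toReal_mono ENNReal.ofReal_ne_top hWv).trans_eq (ENNReal.toReal_ofReal hv.le)
  have hWf : volume W ≠ ∞ := (hWv.trans_lt ENNReal.ofReal_lt_top).ne
  set I := ∫ z in W, F z with hI
  have hIle : ω.card * ((Real.pi / (2 * t)) ^ q * θ) ≤ I := by
    rw [hI, integral_finsetSum _ fun x _ =>
      (integrable_exp_neg_mul_norm_sub_sq (by positivity) x).integrableOn,
      ← nsmul_eq_mul, ← Finset.sum_const]
    refine Finset.sum_le_sum fun x hx => (le_trans ?_ (mul_le_setIntegral_exp ht hδ hW (hω x hx)))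
    gcongr
  have hIv : I ^ 2 / v ≤ ∫ z, F z ^ 2 := by
    -- Cauchy–Schwarz in the form (F - I/v)² ≥ 0, with v in place of the volume of W, which may be
    -- smaller.
    have h1 : ∫ z in W, (2 * (I / v) * F z - (I / v) ^ 2) ≤ ∫ z in W, F z ^ 2 := by
      refine setIntegral_mono ((hFi.integrableOn.const_mul _).sub (integrableOn_const hWf))
        hF2i.integrableOn fun z => ?_
      nlinarith [sq_nonneg (F z - I / v)]
    rw [integral_sub (hFi.integrableOn.const_mul _) (integrableOn_const hWf), integral_const_mul,
      setIntegral_const, smul_eq_mul, ← hI] at h1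
    have h2 := setIntegral_le_integral (s := W) hF2i (Eventually.of_forall fun z => sq_nonneg (F z))
    have h3 : volume.real W * (I / v) ^ 2 ≤ v * (I / v) ^ 2 := by gcongr
    have h4 : 2 * (I / v) * I - v * (I / v) ^ 2 = I ^ 2 / v := by field_simp; ring
    linarith
  rw [hF2int] at hIv
  have h5 : (ω.card * ((Real.pi / (2 * t)) ^ q * θ)) ^ 2 / v ≤ I ^ 2 / v := by gcongr
  have h6 : (Real.pi / t) ^ q * (Real.pi / (4 * t)) ^ q = ((Real.pi / (2 * t)) ^ q) ^ 2 := by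
    rw [sq, ← Real.mul_rpow (by positivity) (by positivity),
      ← Real.mul_rpow (by positivity) (by positivity)]
    congr 1
    field_simp
    norm_num
  have h7 : 0 < (Real.pi / (4 * t)) ^ q := by positivity
  refine le_of_mul_le_mul_left ((le_of_eq ?_).trans (h5.trans hIv)) h7
  rw [mul_pow, mul_pow, ← h6]
  ring

/-- Lower bound for the energy in the critical case, with explicit error terms. -/
lemma le_gamma_mul_rieszEnergy (hd : 0 < d) {t₀ δ θ v : ℝ} (ht₀ : 0 < t₀) (hδ : 0 < δ)
    (hθ : 0 ≤ θ) (hv : 0 < v)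
    (hθt : ∀ t, t₀ ≤ t → θ ≤ 1 - 2 ^ ((d : ℝ) / 2) * Real.exp (-t * δ ^ 2))
    {W : Set (EuclideanSpace ℝ (Fin d))} (hW : MeasurableSet W)
    (hWv : volume W ≤ ENNReal.ofReal v)
    {ω : Finset (EuclideanSpace ℝ (Fin d))} (hω : ∀ x ∈ ω, ∀ z, ‖z - x‖ < δ → z ∈ W)
    {t₁ : ℝ} (ht₁ : t₀ ≤ t₁) :
    Real.pi ^ ((d : ℝ) / 2) * ((ω.card : ℝ) ^ 2 * θ ^ 2 / v) * Real.log (t₁ / t₀) -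
      ω.card * (t₁ ^ ((d : ℝ) / 2) / ((d : ℝ) / 2)) ≤
      Real.Gamma ((d : ℝ) / 2) * rieszEnergy d ω := by
  classical
  have hpi := Real.pi_pos
  have hd' : (0 : ℝ) < d := by exact_mod_cast hd
  set q : ℝ := (d : ℝ) / 2 with hq
  have hq0 : 0 < q := by positivity
  set B := Real.pi ^ q * ((ω.card : ℝ) ^ 2 * θ ^ 2 / v) with hB
  have hpos : ∀ p ∈ ω.offDiag, 0 < ‖p.1 - p.2‖ := fun p hp =>
    norm_pos_iff.2 (sub_ne_zero.2 (Finset.mem_offDiag.1 hp).2.2)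
  have hterm : ∀ p ∈ ω.offDiag, Real.Gamma q * (1 / ‖p.1 - p.2‖ ^ (d : ℝ)) =
      ∫ t in Set.Ioi (0 : ℝ), t ^ (q - 1) * Real.exp (-(‖p.1 - p.2‖ ^ 2 * t)) := fun p hp => by
    have h0 := hpos p hp
    rw [Real.integral_rpow_mul_exp_neg_mul_Ioi hq0 (by positivity), mul_comm, one_div, one_div,
      Real.inv_rpow (by positivity), ← Real.rpow_natCast, ← Real.rpow_mul h0.le]
    congr 3
    rw [hq]; push_cast; ring
  have hint : ∀ p ∈ ω.offDiag, IntegrableOn (fun t : ℝ =>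
      t ^ (q - 1) * Real.exp (-(‖p.1 - p.2‖ ^ 2 * t))) (Set.Ioi 0) := fun p hp => by
    refine Integrable.of_integral_ne_zero ?_
    rw [← hterm p hp]
    have := hpos p hp
    have := Real.Gamma_pos_of_pos hq0
    positivity
  have hE : Real.Gamma q * rieszEnergy d ω = ∫ t in Set.Ioi (0 : ℝ), ∑ p ∈ ω.offDiag,
      t ^ (q - 1) * Real.exp (-(‖p.1 - p.2‖ ^ 2 * t)) := by
    rw [integral_finsetSum _ hint, ← Finset.sum_congr rfl hterm, ← Finset.mul_sum]
    unfold rieszEnergy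
    congr 1
  have hsub : Set.Ioc t₀ t₁ ⊆ Set.Ioi 0 := fun t ht => ht₀.trans ht.1
  -- The Mellin integrand is nonnegative, so restricting t is harmless. The subtracted term is the
  -- diagonal, which the Gaussian energy includes and the Riesz energy does not.
  have hle : ∫ t in Set.Ioc t₀ t₁, (B * t⁻¹ - ω.card * t ^ (q - 1)) ≤
      Real.Gamma q * rieszEnergy d ω := by
    rw [hE]
    refine le_trans (setIntegral_mono_on ?_ ((integrable_finsetSum _ hint).mono_measure
      (Measure.restrict_mono hsub le_rfl)) measurableSet_Ioc fun t ht => ?_)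
      (setIntegral_mono_set (integrable_finsetSum _ hint) ?_ hsub.eventuallyLE)
    · refine (ContinuousOn.integrableOn_Icc fun t ht => ?_).mono_set Set.Ioc_subset_Icc_self
      have h0 : t ≠ 0 := (ht₀.trans_le ht.1).ne'
      exact ((continuousAt_const.mul (continuousAt_inv₀ h0)).sub (continuousAt_const.mul
        (Real.continuousAt_rpow_const _ _ (Or.inl h0)))).continuousWithinAt
    · have ht0 : 0 < t := ht₀.trans ht.1
      have h1 := le_sum_sum_exp ht0 hδ hθ hv (hθt t ht.1.le) hW hWv hω
      have h2 : ∑ x ∈ ω, ∑ y ∈ ω, Real.exp (-t * ‖x - y‖ ^ 2) =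
          ω.card + ∑ p ∈ ω.offDiag, Real.exp (-(‖p.1 - p.2‖ ^ 2 * t)) := by
        rw [← Finset.sum_product', ← Finset.diag_union_offDiag,
          Finset.sum_union (Finset.disjoint_diag_offDiag ω), Finset.sum_diag]
        simp [mul_comm]
      rw [h2] at h1
      rw [← Finset.mul_sum]
      have h3 : B * t⁻¹ = t ^ (q - 1) * ((Real.pi / t) ^ q * ((ω.card : ℝ) ^ 2 * θ ^ 2 / v)) := by
        rw [Real.div_rpow hpi.le ht0.le, Real.rpow_sub ht0, Real.rpow_one, hB]
        have : t ^ q ≠ 0 := by positivity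
        field_simp
      have h4 := mul_le_mul_of_nonneg_left h1 (Real.rpow_nonneg ht0.le (q - 1))
      rw [h3]
      linarith
    · refine (ae_restrict_iff' measurableSet_Ioi).2 (Eventually.of_forall fun t ht => ?_)
      have : (0 : ℝ) < t := ht
      exact Finset.sum_nonneg fun p _ => by positivity
  refine le_trans ?_ hle
  have h0 : (0 : ℝ) ∉ Set.uIcc t₀ t₁ := by
    rw [Set.uIcc_of_le ht₁]
    exact fun h => ht₀.not_ge h.1
  rw [← intervalIntegral.integral_of_le ht₁, intervalIntegral.integral_sub
    ((intervalIntegrable_inv_iff.2 (Or.inr h0)).const_mul _)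
    ((intervalIntegral.intervalIntegrable_rpow (Or.inr h0)).const_mul _),
    intervalIntegral.integral_const_mul, intervalIntegral.integral_const_mul, integral_inv h0,
    integral_rpow (Or.inr ⟨by linarith, h0⟩), sub_add_cancel]
  have : (t₁ ^ q - t₀ ^ q) / q ≤ t₁ ^ q / q := by
    gcongr
    have : 0 < t₀ ^ q := by positivity
    linarith
  gcongr

lemma unitBallVolume_eq (hd : 0 < d) :
    unitBallVolume d = Real.pi ^ ((d : ℝ) / 2) / (d / 2 * Real.Gamma ((d : ℝ) / 2)) := by
  have hd' : (0 : ℝ) < d := by exact_mod_cast hd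
  have : Nonempty (Fin d) := ⟨⟨0, hd⟩⟩
  have hg : 0 < Real.Gamma ((d : ℝ) / 2 + 1) := Real.Gamma_pos_of_pos (by positivity)
  rw [unitBallVolume, Measure.real, EuclideanSpace.volume_ball, Fintype.card_fin,
    ENNReal.ofReal_one, one_pow, one_mul, ENNReal.toReal_ofReal (by positivity),
    Real.Gamma_add_one (by positivity), Real.sqrt_eq_rpow, ← Real.rpow_natCast,
    ← Real.rpow_mul Real.pi_pos.le]
  congr 2
  ring

lemma eventually_le_normRieszEnergy_self (hd : 0 < d)
    {A : Set (EuclideanSpace ℝ (Fin d))} (hA : Bornology.IsBounded A) {a v : ℝ}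
    (ha : a < unitBallVolume d) (hv : volume (closure A) < ENNReal.ofReal v) :
    ∀ᶠ N in atTop, ENNReal.ofReal (a / v) ≤ normRieszEnergy d d A N := by
  have hd' : (0 : ℝ) < d := by exact_mod_cast hd
  have hpi := Real.pi_pos
  have hβ := unitBallVolume_pos d
  have hv0 : 0 < v := by simpa using (zero_le (a := volume (closure A))).trans_lt hv
  set q : ℝ := (d : ℝ) / 2 with hq
  have hq0 : 0 < q := by positivity
  have hΓ := Real.Gamma_pos_of_pos hq0
  obtain ⟨θ, hθa, hθ0, hθ1⟩ : ∃ θ : ℝ, a < unitBallVolume d * θ ^ 2 ∧ 0 < θ ∧ θ < 1 := by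
    have hcont : Tendsto (fun θ : ℝ => unitBallVolume d * θ ^ 2) (𝓝[<] 1)
        (𝓝 (unitBallVolume d * 1 ^ 2)) :=
      ((by fun_prop : Continuous fun θ : ℝ => unitBallVolume d * θ ^ 2).tendsto 1).mono_left
        nhdsWithin_le_nhds
    exact ((hcont.eventually_const_lt (by simpa using ha)).and (Ioo_mem_nhdsLT one_pos)).exists
  obtain ⟨δ, hWv, hδ⟩ : ∃ δ : ℝ, volume (Metric.cthickening δ A) < ENNReal.ofReal v ∧ 0 < δ := by
    have hlim : Tendsto (fun r => volume (Metric.cthickening r A)) (𝓝 0)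
        (𝓝 (volume (closure A))) :=
      tendsto_measure_cthickening ⟨1, one_pos, hA.cthickening.measure_lt_top.ne⟩
    exact (((hlim.mono_left nhdsWithin_le_nhds).eventually_lt_const hv).and
      (self_mem_nhdsWithin (s := Set.Ioi (0 : ℝ)))).exists
  obtain ⟨t₀, ht₀, hθt⟩ : ∃ t₀ : ℝ, 0 < t₀ ∧
      ∀ t, t₀ ≤ t → θ ≤ 1 - 2 ^ q * Real.exp (-t * δ ^ 2) := by
    have hlim : Tendsto (fun t : ℝ => 1 - 2 ^ q * Real.exp (-(t * δ ^ 2))) atTop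
        (𝓝 (1 - 2 ^ q * 0)) :=
      tendsto_const_nhds.sub (tendsto_const_nhds.mul (Real.tendsto_exp_neg_atTop_nhds_zero.comp
        (tendsto_id.atTop_mul_const (by positivity))))
    obtain ⟨t₀, h⟩ := eventually_atTop.1 (hlim.eventually_const_le (by simpa using hθ1))
    exact ⟨max t₀ 1, by positivity, fun t ht => by
      simpa [neg_mul] using h t ((le_max_left _ _).trans ht)⟩
  -- The errors of order N², from log t₀ and from the diagonal. The cutoff is t₁ = N^(1/q): then
  -- t₁^q = N keeps the diagonal at N²/q, while log t₁ = (2/d) log N gives the main term.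
  set K := Real.pi ^ q * (θ ^ 2 / v) * Real.log t₀ + 1 / q with hK
  have ht1 : Tendsto (fun N : ℕ => (N : ℝ) ^ (1 / q)) atTop atTop :=
    (tendsto_rpow_atTop (by positivity)).comp tendsto_natCast_atTop_atTop
  have hlog : Tendsto (fun N : ℕ => (Real.Gamma q * ((unitBallVolume d * θ ^ 2 - a) / v)) *
      Real.log N) atTop atTop :=
    (Real.tendsto_log_atTop.comp tendsto_natCast_atTop_atTop).const_mul_atTop
      (by have : 0 < unitBallVolume d * θ ^ 2 - a := by linarith
          positivity)
  filter_upwards [ht1.eventually_ge_atTop t₀, hlog.eventually_ge_atTop K,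
    eventually_gt_atTop 1] with N hNt hNK hN1
  refine le_normRieszEnergy (rieszTau_self_pos hN1) fun ω hω hcard => ?_
  have hN0 : (0 : ℝ) < N := by exact_mod_cast (zero_lt_one.trans hN1)
  have hmain := le_gamma_mul_rieszEnergy hd ht₀ hδ hθ0.le hv0 hθt
    Metric.isClosed_cthickening.measurableSet hWv.le (ω := ω) (fun x hx z hz =>
      Metric.mem_cthickening_of_dist_le z x δ A (hω hx) (by rw [dist_eq_norm]; exact hz.le)) hNt
  rw [hcard, ← hq, Real.log_div (by positivity) ht₀.ne', Real.log_rpow hN0,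
    ← Real.rpow_mul hN0.le, one_div_mul_cancel hq0.ne', Real.rpow_one] at hmain
  have hβq : Real.pi ^ q = unitBallVolume d * (q * Real.Gamma q) := by
    rw [unitBallVolume_eq hd, ← hq, div_mul_cancel₀ _ (by positivity)]
  rw [rieszTau_self]
  refine le_of_mul_le_mul_left (le_trans ?_ hmain) hΓ
  have hkey : Real.pi ^ q * ((N : ℝ) ^ 2 * θ ^ 2 / v) * (1 / q * Real.log N - Real.log t₀) -
      N * (N / q) - Real.Gamma q * (a / v * ((N : ℝ) ^ 2 * Real.log N)) = (N : ℝ) ^ 2 *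
      (Real.Gamma q * ((unitBallVolume d * θ ^ 2 - a) / v) * Real.log N - K) := by
    rw [hK, hβq]
    field_simp
    ring
  have : 0 ≤ (N : ℝ) ^ 2 *
      (Real.Gamma q * ((unitBallVolume d * θ ^ 2 - a) / v) * Real.log N - K) :=
    mul_nonneg (by positivity) (by linarith)
  linarith

theorem hasRieszLimit_self (hd : 0 < d) {A : Set (EuclideanSpace ℝ (Fin d))}
    (hA : Bornology.IsBounded A) (hA' : IsAlmostClopen A) :
    HasRieszLimit d d A (ENNReal.ofReal (unitBallVolume d) * volume A ^ (-(1 : ℝ))) := by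
  have hβ := unitBallVolume_pos d
  refine tendsto_mul_rpow_neg_of_bounds one_pos (ENNReal.ofReal_pos.2 hβ) ENNReal.ofReal_lt_top
    hA.measure_lt_top ?_ ?_
  · intro a v ha hv0 hv
    rw [Real.rpow_neg_one, ← div_eq_mul_inv]
    refine eventually_normRieszEnergy_self_le hd hA (ENNReal.ofReal_lt_ofReal_iff'.1 ha).1 hv0 ?_
    rw [Measure.real, ← ENNReal.toReal_ofReal hv0.le]
    exact ENNReal.toReal_strict_mono hA.measure_lt_top.ne hv
  · intro a v _ ha _ hv
    rw [Real.rpow_neg_one, ← div_eq_mul_inv]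
    rw [← volume_closure_eq_of_frontier hA'.2] at hv
    exact eventually_le_normRieszEnergy_self hd hA (ENNReal.ofReal_lt_ofReal_iff'.1 ha).1 hv

end CriticalLower

end

theorem theorem5p1 (d : ℕ) (hd : 0 < d) (s : ℝ) (hs : (d : ℝ) ≤ s) :
    ∃ gU : ℝ≥0∞, 0 < gU ∧ gU < ∞ ∧ HasRieszLimit s d (unitCube d) gU ∧
      ∀ A : Set (EuclideanSpace ℝ (Fin d)), Bornology.IsBounded A → IsAlmostClopen A →
        HasRieszLimit s d A (gU * volume A ^ (-(s / (d : ℝ)))) := by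
  obtain ⟨gU, h0, htop, h⟩ : ∃ gU : ℝ≥0∞, 0 < gU ∧ gU < ∞ ∧
      ∀ A : Set (EuclideanSpace ℝ (Fin d)), Bornology.IsBounded A → IsAlmostClopen A →
        HasRieszLimit s d A (gU * volume A ^ (-(s / (d : ℝ)))) := by
    rcases hs.eq_or_lt with rfl | hlt
    · have hd' : (d : ℝ) ≠ 0 := by positivity
      rw [div_self hd']
      exact ⟨_, ENNReal.ofReal_pos.2 (unitBallVolume_pos d), ENNReal.ofReal_lt_top,
        fun A hA hA' => hasRieszLimit_self hd hA hA'⟩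
    · exact exists_hasRieszLimit_of_lt hd hlt
  refine ⟨gU, h0, htop, ?_, h⟩
  have := h _ (isBounded_unitCube d) (isAlmostClopen_unitCube d)
  rwa [volume_unitCube, ENNReal.one_rpow, mul_one] at this
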